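/- There is a universal constant $A>0$ such that the following holds. Let $X$ be a real-valued random variable on a probability space, and suppose there is a number $r>0$ such that $\mathbb{E}[e^{r|X|}]<\infty$ and the characteristic function $u\mapsto \mathbb{E}[e^{iuX}]$ (well defined for complex $u$ with $|u|\le r$) does not vanish on the closed disk $\{u\in\mathbb{C}:|u|\le r\}$. Let $\bar X=X-\mathbb{E}[X]$, let $F_{\bar X}(x)=\mathbb{P}(\bar X\le x)$ be its cumulative distribution function, let $\Phi$ be the cumulative distribution function of the standard Gaussian $N(0,1)$, let $\sigma\ge 0$ with $\sigma^2=\operatorname{Var}(X)$, and let $\log^+=\max(\log,0)$, with $\log^+ 0=0$. Then the maximum $\max_{|u|=r}|\mathbb{E}[e^{iuX}]|$ over complex $u$ is attained, and $$\sup_{x\in\mathbb{R}}|F_{\bar X}(x)-\Phi(x)|\le 2|\sigma-1|+A\Bigl(1+\log^+\log\max_{|u|=r}\bigl|\mathbb{E}[e^{iuX}]\bigr|\Bigr)r^{-1}.$$ -/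

import Mathlib

open MeasureTheory ProbabilityTheory

noncomputable section

/-- The characteristic function `u ↦ E[exp (i u X)]` of a real random variable `X`, at a complex
argument `u`. It is an honest expectation as soon as `exp (|u| |X|)` is integrable. -/
def complexCharFun {Ω : Type*} [MeasurableSpace Ω] (P : Measure Ω) (X : Ω → ℝ) (u : ℂ) : ℂ :=
  ∫ ω, Complex.exp (Complex.I * u * (X ω : ℂ)) ∂P

/-- The centered random variable `X - E[X]`. -/
def centered {Ω : Type*} [MeasurableSpace Ω] (P : Measure Ω) (X : Ω → ℝ) : Ω → ℝ :=
  fun ω => X ω - ∫ ω', X ω' ∂P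

/-- The Kolmogorov–Smirnov distance `sup_x |F_μ(x) - F_ν(x)|` between two probability measures on
the real line; the supremum is over a bounded family, since both functions take values in
`[0, 1]`. -/
def ksDist (μ ν : Measure ℝ) : ℝ := ⨆ x : ℝ, |cdf μ x - cdf ν x|

end

/-! Rotate the variable to `f z = E[exp (z X)]`, which has no zeros on the disk, and let `G` be the
logarithm of the transform of the centered variable. Since `|E[exp (z Y)]| ≤ E[exp (Re z · Y)]`, the
harmonic function `Re G` is maximal on each vertical segment at its real point (the ridge property).
As in Marcinkiewicz's theorem, this forces `G` to be nearly quadratic, hence the law to be nearly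
Gaussian.

Compare `Re G` with its reflection in the line `Im z = T`. On the real axis the ridge property
orders the two, on the line they agree, and on distant vertical sides the error is damped
exponentially towards the middle. The maximum principle then gives an almost-sign of `Im G'` in the
upper half disk (`im_deriv_lower_bound`). So `G' + ε z` is typically real on a circle of radius `ρ`,
hence close to linear near 0 (`norm_sub_linear_le_of_typicallyReal`), and integration gives `G z = s
z² / 2 + O(|z|³ / ρ)`, where `s` is the variance (`norm_sub_quadratic_le_of_ridge`).

Borel–Carathéodory bounds `G'` by a multiple of `B / r` with `B = max 1 (log M)`. The damping at
scale `ρ` is `exp (-c r / ρ)`, so `ρ` of order `r / (1 + log⁺ log M)` already cancels `B`: this is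
the source of the double logarithm. Esseen's inequality turns the cubic error into distance `O(1 /
ρ)` from `N(0, σ²)`, and replacing `σ` by 1 costs `2 |σ - 1|`. -/

/-! ### Reflection and a barrier: almost-positivity of `Im g'`. -/

/-- A real function that is nonnegative to the left of one of its zeros has a nonpositive derivative
there. -/
theorem HasDerivAt.nonpos_of_nonneg_left {ψ : ℝ → ℝ} {d a T : ℝ} (haT : a < T)
    (hd : HasDerivAt ψ d T) (h0 : ψ T = 0) (hpos : ∀ y ∈ Set.Ico a T, 0 ≤ ψ y) : d ≤ 0 := by
  have h1 : Filter.Tendsto (slope ψ T) (nhdsWithin T (Set.Iio T)) (nhds d) :=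
    (hasDerivAt_iff_tendsto_slope.1 hd).mono_left
      (nhdsWithin_mono _ fun x hx => ne_of_lt hx)
  refine le_of_tendsto h1 ?_
  filter_upwards [Ico_mem_nhdsLT haT] with y hy
  rw [slope_def_field, h0, sub_zero]
  exact div_nonpos_of_nonneg_of_nonpos (hpos y hy) (by linarith [hy.2])

theorem re_sin_mul_add_I_mul (a T : ℝ) (z : ℂ) :
    (Complex.sin (a * (T + Complex.I * z))).re =
      Real.cosh (a * z.re) * Real.sin (a * (T - z.im)) := by
  have : (a * (T + Complex.I * z) : ℂ)
      = ((a * (T - z.im) : ℝ) : ℂ) + ((a * z.re : ℝ) : ℂ) * Complex.I := by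
    apply Complex.ext <;> simp
    left; ring
  rw [this, Complex.sin_add_mul_I, ← Complex.ofReal_sin, ← Complex.ofReal_cosh,
    ← Complex.ofReal_cos, ← Complex.ofReal_sinh, Complex.add_re, Complex.re_mul_ofReal,
    Complex.ofReal_re, mul_assoc, Complex.re_ofReal_mul, Complex.re_ofReal_mul, Complex.I_re]
  ring

theorem hasDerivAt_re_comp_vertical {g : ℂ → ℂ} {z : ℂ} (hg : DifferentiableAt ℂ g z)
    {x c y : ℝ} (hz : (x : ℂ) + ((y + c : ℝ) : ℂ) * Complex.I = z) :
    HasDerivAt (fun t : ℝ => (g ((x : ℂ) + ((t + c : ℝ) : ℂ) * Complex.I)).re)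
      (-(deriv g z).im) y := by
  have h1 : HasDerivAt (fun t : ℂ => g ((x : ℂ) + (t + (c : ℂ)) * Complex.I))
      (deriv g z * Complex.I) (y : ℂ) := by
    have h2 : HasDerivAt (fun t : ℂ => (x : ℂ) + (t + (c : ℂ)) * Complex.I) Complex.I (y : ℂ) := by
      simpa using (((hasDerivAt_id (y : ℂ)).add_const (c : ℂ)).mul_const Complex.I).const_add (x : ℂ)
    have h3 : HasDerivAt g (deriv g z) ((x : ℂ) + ((y : ℂ) + (c : ℂ)) * Complex.I) := by
      have : (x : ℂ) + ((y : ℂ) + (c : ℂ)) * Complex.I = z := by rw [← hz]; push_cast; ring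
      rw [this]; exact hg.hasDerivAt
    exact h3.comp (y : ℂ) h2
  have h4 := h1.real_of_complex
  simpa using h4

/-- The key lower bound: if `Re g` is symmetric and is maximal on each vertical segment at its real
point, then `Im g'` is almost nonnegative in the upper half of the domain. -/
theorem im_deriv_lower_bound {g : ℂ → ℂ} {R S X T x : ℝ}
    (hg : DifferentiableOn ℂ g (Metric.ball 0 R))
    (hS : ∀ z ∈ Metric.ball (0 : ℂ) R, ‖deriv g z‖ ≤ S)
    (hsym : ∀ z ∈ Metric.ball (0 : ℂ) R, (g ((starRingEnd ℂ) z)).re = (g z).re)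
    (hsym' : ∀ z ∈ Metric.ball (0 : ℂ) R, deriv g ((starRingEnd ℂ) z) = (starRingEnd ℂ) (deriv g z))
    (hridge : ∀ z ∈ Metric.ball (0 : ℂ) R, (g z).re ≤ (g (z.re : ℂ)).re)
    (hT : 0 < T) (hX : 0 < X) (hXT : X + 2 * T < R) (hx : |x| ≤ X / 2) :
    -(Real.pi * S * Real.exp (-(Real.pi * X / (4 * T)))) ≤ (deriv g (x + T * Complex.I)).im := by
  have hR : 0 < R := by linarith
  have hS0 : 0 ≤ S := (norm_nonneg _).trans (hS 0 (by simpa using hR))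
  have hpi := Real.pi_pos
  have hmem : ∀ z : ℂ, |z.re| ≤ X → |z.im| ≤ 2 * T → z ∈ Metric.ball (0 : ℂ) R := by
    intro z h1 h2
    rw [mem_ball_zero_iff]
    exact (Complex.norm_le_abs_re_add_abs_im z).trans_lt (by linarith)
  -- With this frequency the barrier `cosh (a x) sin (a (T - y))` is harmonic, vanishes on `y = T`,
  -- and is nonnegative for `0 ≤ y ≤ T`.
  set a : ℝ := Real.pi / (2 * T) with ha
  have ha0 : 0 < a := by positivity
  have haT : a * T = Real.pi / 2 := by rw [ha]; field_simp
  -- Chosen so that on `|Re z| = X` the barrier dominates `2 S (T - y)`, the most that `Re g` can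
  -- change between `z` and its mirror image; Jordan's inequality gives `sin (a (T - y)) ≥ (T - y) /
  -- T`.
  set κ : ℝ := 2 * T * S / Real.cosh (a * X) with hκ
  have hκ0 : 0 ≤ κ := by have := Real.cosh_pos (a * X); positivity
  set U : Set ℂ := Set.Ioo (-X) X ×ℂ Set.Ioo 0 T with hU
  have hclos : closure U = Set.Icc (-X) X ×ℂ Set.Icc 0 T := by
    rw [hU, Complex.closure_reProdIm, closure_Ioo (by linarith), closure_Ioo hT.ne]
  set Q : ℂ → ℂ := fun z => g z - g (z - 2 * T * Complex.I)
    + κ * Complex.sin (a * (T + Complex.I * z)) with hQ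
  have hQre : ∀ z, (Q z).re = (g z).re - (g (z - 2 * T * Complex.I)).re
      + κ * (Real.cosh (a * z.re) * Real.sin (a * (T - z.im))) := by
    intro z
    rw [← re_sin_mul_add_I_mul, hQ]
    simp only [Complex.add_re, Complex.sub_re, Complex.re_ofReal_mul]
  have hin : ∀ z ∈ Set.Icc (-X) X ×ℂ Set.Icc 0 T, z ∈ Metric.ball (0 : ℂ) R ∧
      z - 2 * T * Complex.I ∈ Metric.ball (0 : ℂ) R := by
    rintro z ⟨h1, h2⟩
    simp only [Set.mem_preimage, Set.mem_Icc] at h1 h2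
    refine ⟨hmem z (abs_le.2 h1) (abs_le.2 ⟨by linarith, by linarith⟩), hmem _ ?_ ?_⟩
    · simpa using abs_le.2 h1
    · simp only [Complex.sub_im, Complex.mul_im, Complex.mul_re, Complex.I_re, Complex.I_im]
      norm_num
      exact abs_le.2 ⟨by linarith, by linarith⟩
  -- The shift `z - 2iT` is the conjugate of the mirror image of `z` in `Im = T`; it keeps the
  -- comparison function holomorphic, while conjugation symmetry makes its real part that of the
  -- reflection.
  have hrefl : ∀ z ∈ Set.Icc (-X) X ×ℂ Set.Icc 0 T, (g (z - 2 * T * Complex.I)).re =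
      (g ((z.re : ℂ) + ((2 * T - z.im : ℝ) : ℂ) * Complex.I)).re := by
    intro z hz
    rw [← hsym _ (hin z hz).2]
    congr 2
    apply Complex.ext <;> simp
    ring
  have hQd : DifferentiableOn ℂ Q (Set.Icc (-X) X ×ℂ Set.Icc 0 T) := by
    refine DifferentiableOn.add (DifferentiableOn.sub (hg.mono fun z hz => (hin z hz).1) ?_) ?_
    · exact hg.comp (by fun_prop) fun z hz => (hin z hz).2
    · fun_prop
  have hbd : ∀ z ∈ frontier U, 0 ≤ (Q z).re := by
    intro z hz
    have hz1 : z ∈ Set.Icc (-X) X ×ℂ Set.Icc 0 T := hclos ▸ frontier_subset_closure hz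
    have hz2 : z ∉ U := by
      have : IsOpen U := isOpen_Ioo.reProdIm isOpen_Ioo
      intro h; exact (this.frontier_eq ▸ hz).2 h
    have hb := hin z hz1
    obtain ⟨h1, h2⟩ := id hz1
    simp only [Set.mem_preimage, Set.mem_Icc] at h1 h2
    have hsin : 2 / Real.pi * (a * (T - z.im)) ≤ Real.sin (a * (T - z.im)) := by
      refine Real.mul_le_sin (mul_nonneg ha0.le (by linarith)) ?_
      rw [← haT]; exact mul_le_mul_of_nonneg_left (by linarith) ha0.le
    have hsin' : (T - z.im) / T ≤ Real.sin (a * (T - z.im)) := by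
      refine le_trans (le_of_eq ?_) hsin
      rw [ha]; field_simp
    have hsin0 : 0 ≤ Real.sin (a * (T - z.im)) :=
      le_trans (div_nonneg (by linarith) hT.le) hsin'
    have hbar : 0 ≤ κ * (Real.cosh (a * z.re) * Real.sin (a * (T - z.im))) :=
      mul_nonneg hκ0 (mul_nonneg (Real.cosh_pos _).le hsin0)
    rw [hQre]
    rcases eq_or_lt_of_le h2.1 with h0 | h0
    · have hzz : z = (z.re : ℂ) := by apply Complex.ext <;> simp [← h0]
      have := hridge _ hb.2
      have e : (z - 2 * T * Complex.I).re = z.re := by simp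
      rw [e, ← hzz] at this
      linarith
    rcases eq_or_lt_of_le h2.2 with h3 | h3
    · rw [h3] at hbar
      rw [hrefl z hz1, h3]
      have : (z.re : ℂ) + ((2 * T - T : ℝ) : ℂ) * Complex.I = z := by
        apply Complex.ext <;> simp [h3]; ring
      rw [this]; linarith
    · have hre : |z.re| = X := by
        have : ¬ (-X < z.re ∧ z.re < X) := fun h => hz2 ⟨h, ⟨h0, h3⟩⟩
        rcases eq_or_lt_of_le h1.1 with h4 | h4
        · rw [← h4, abs_neg, abs_of_pos hX]
        · rcases eq_or_lt_of_le h1.2 with h5 | h5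
          · rw [h5, abs_of_pos hX]
          · exact absurd ⟨h4, h5⟩ this
      have hcosh : Real.cosh (a * z.re) = Real.cosh (a * X) := by
        rw [← Real.cosh_abs, abs_mul, hre, abs_of_pos ha0]
      set w : ℂ := (z.re : ℂ) + ((2 * T - z.im : ℝ) : ℂ) * Complex.I with hw
      have hwb : w ∈ Metric.ball (0 : ℂ) R := by
        apply hmem
        · simp [hw, hre]
        · simp only [hw, Complex.add_im, Complex.ofReal_im, Complex.im_ofReal_mul, Complex.I_im]
          rw [abs_le]; constructor <;> linarith
      have hmv := (convex_ball (0 : ℂ) R).norm_image_sub_le_of_norm_deriv_le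
        (fun y hy => hg.differentiableAt (Metric.isOpen_ball.mem_nhds hy)) hS hwb hb.1
      have hzw : ‖z - w‖ = 2 * (T - z.im) := by
        have : z - w = ((-(2 * (T - z.im)) : ℝ) : ℂ) * Complex.I := by
          apply Complex.ext <;> simp [hw]; ring
        rw [this, norm_mul, Complex.norm_I, mul_one, Complex.norm_real, Real.norm_eq_abs,
          abs_neg, abs_of_nonneg (by linarith)]
      rw [hzw] at hmv
      have hre1 : -(S * (2 * (T - z.im))) ≤ (g z).re - (g w).re := by
        have := (abs_le.1 ((Complex.abs_re_le_norm (g z - g w)).trans hmv)).1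
        simpa using this
      rw [hrefl z hz1, hcosh]
      have hk : S * (2 * (T - z.im)) ≤
          κ * (Real.cosh (a * X) * Real.sin (a * (T - z.im))) := by
        have hc := Real.cosh_pos (a * X)
        calc S * (2 * (T - z.im)) = 2 * T * S * ((T - z.im) / T) := by field_simp
          _ ≤ 2 * T * S * Real.sin (a * (T - z.im)) :=
            mul_le_mul_of_nonneg_left hsin' (by positivity)
          _ = _ := by rw [hκ]; field_simp
      linarith
  -- Minimum principle for `Re Q`, as the maximum modulus principle for `exp (-Q)`.
  have hQpos : ∀ z ∈ Set.Icc (-X) X ×ℂ Set.Icc 0 T, 0 ≤ (Q z).re := by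
    intro z hz
    have hbU : Bornology.IsBounded U :=
      (Metric.isBounded_Ioo _ _).reProdIm (Metric.isBounded_Ioo _ _)
    have hd : DiffContOnCl ℂ (fun z => Complex.exp (-Q z)) U := by
      apply DifferentiableOn.diffContOnCl
      rw [hclos]
      exact hQd.neg.cexp
    have := Complex.norm_le_of_forall_mem_frontier_norm_le hbU hd (C := 1) (fun w hw => by
      rw [Complex.norm_exp, Real.exp_le_one_iff]
      simpa using hbd w hw) (hclos ▸ hz : z ∈ closure U)
    rw [Complex.norm_exp, Real.exp_le_one_iff] at this
    simpa using this
  have hxX : |x| ≤ X := by linarith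
  have hzT : (x : ℂ) + T * Complex.I ∈ Metric.ball (0 : ℂ) R := by
    apply hmem
    · simpa using hxX
    · simp [abs_of_pos hT]; linarith
  have hzT' : (x : ℂ) + ((-T : ℝ) : ℂ) * Complex.I ∈ Metric.ball (0 : ℂ) R := by
    apply hmem
    · simpa using hxX
    · simp [abs_of_pos hT]; linarith
  have hd1 := hasDerivAt_re_comp_vertical (c := 0) (y := T) (x := x)
    (hg.differentiableAt (Metric.isOpen_ball.mem_nhds hzT)) (by simp)
  have hd2 := hasDerivAt_re_comp_vertical (c := -(2 * T)) (y := T) (x := x)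
    (hg.differentiableAt (Metric.isOpen_ball.mem_nhds hzT')) (by push_cast; ring)
  have hd3 : HasDerivAt (fun y : ℝ => κ * (Real.cosh (a * x) * Real.sin (a * (T - y))))
      (-(κ * (Real.cosh (a * x) * a))) T := by
    have h1 : HasDerivAt (fun y : ℝ => a * (T - y)) (-a) T := by
      simpa using ((hasDerivAt_id T).const_sub T).const_mul a
    have h2 := ((h1.sin).const_mul (Real.cosh (a * x))).const_mul κ
    convert! h2 using 1
    simp
  -- `Re Q` is nonnegative below the line `Im = T` and zero on it. The vertical derivatives of `Re
  -- g` at `x ± iT` are opposite, so this yields twice the desired bound.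
  have hfin := HasDerivAt.nonpos_of_nonneg_left hT ((hd1.sub hd2).add hd3)
    (by
      have e := hsym _ hzT
      have : (starRingEnd ℂ) ((x : ℂ) + T * Complex.I)
        = (x : ℂ) + ((T + -(2 * T) : ℝ) : ℂ) * Complex.I := by
        apply Complex.ext <;> simp; ring
      rw [this] at e
      simp only [Pi.add_apply, Pi.sub_apply, e]
      simp)
    (fun y hy => by
      have := hQpos ((x : ℂ) + y * Complex.I) ⟨by simpa using abs_le.1 hxX,
        by simpa using ⟨hy.1, hy.2.le⟩⟩
      rw [hQre] at this
      have e : (x : ℂ) + y * Complex.I - 2 * T * Complex.I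
        = (x : ℂ) + ((y + -(2 * T) : ℝ) : ℂ) * Complex.I := by push_cast; ring
      rw [e] at this
      simpa using this)
  have hconj : (deriv g ((x : ℂ) + ((-T : ℝ) : ℂ) * Complex.I)).im
      = -(deriv g (x + T * Complex.I)).im := by
    have e := hsym' _ hzT
    have : (starRingEnd ℂ) ((x : ℂ) + T * Complex.I)
        = (x : ℂ) + ((-T : ℝ) : ℂ) * Complex.I := by
      apply Complex.ext <;> simp
    rw [this] at e
    rw [e, Complex.conj_im]
  rw [hconj] at hfin
  have hc := Real.cosh_pos (a * X)
  have hratio : Real.cosh (a * x) ≤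
      2 * Real.exp (-(Real.pi * X / (4 * T))) * Real.cosh (a * X) := by
    have h1 : Real.cosh (a * x) ≤ Real.exp (a * (X / 2)) := by
      calc Real.cosh (a * x) ≤ Real.cosh (a * (X / 2)) := by
            rw [Real.cosh_le_cosh, abs_mul, abs_mul, abs_of_pos (by linarith : 0 < X / 2)]
            exact mul_le_mul_of_nonneg_left hx (abs_nonneg _)
        _ ≤ Real.exp (a * (X / 2)) := by
            rw [Real.cosh_eq]
            have : Real.exp (-(a * (X / 2))) ≤ Real.exp (a * (X / 2)) :=
              Real.exp_le_exp.2 (by have : 0 < a * (X / 2) := by positivity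
                                    linarith)
            linarith
    have h2 : Real.exp (a * X) ≤ 2 * Real.cosh (a * X) := by
      rw [Real.cosh_eq]; linarith [Real.exp_pos (-(a * X))]
    calc Real.cosh (a * x) ≤ Real.exp (a * (X / 2)) := h1
      _ = Real.exp (-(Real.pi * X / (4 * T))) * Real.exp (a * X) := by
          rw [← Real.exp_add, ha]; congr 1; field_simp; ring
      _ ≤ Real.exp (-(Real.pi * X / (4 * T))) * (2 * Real.cosh (a * X)) :=
          mul_le_mul_of_nonneg_left h2 (Real.exp_pos _).le
      _ = _ := by ring
  have hk : κ * (Real.cosh (a * x) * a) ≤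
      2 * (Real.pi * S * Real.exp (-(Real.pi * X / (4 * T)))) := by
    calc κ * (Real.cosh (a * x) * a) = κ * a * Real.cosh (a * x) := by ring
      _ ≤ κ * a * (2 * Real.exp (-(Real.pi * X / (4 * T))) * Real.cosh (a * X)) :=
        mul_le_mul_of_nonneg_left hratio (by positivity)
      _ = _ := by rw [hκ, ha]; field_simp
  linarith

/-! ### Typically real functions and the quadratic approximation. -/

/-- A typically real function on a disk is close to its linear part near the centre. -/
theorem norm_sub_linear_le_of_typicallyReal {G : ℂ → ℂ} {R ρ s : ℝ}
    (hG : DifferentiableOn ℂ G (Metric.ball 0 R)) (hρ : 0 < ρ) (hρR : ρ < R) (h0 : G 0 = 0)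
    (hs : 0 < s) (hd : deriv G 0 = s) (hIm : ∀ z : ℂ, ‖z‖ = ρ → 0 ≤ z.im * (G z).im)
    {z : ℂ} (hz : ‖z‖ ≤ ρ / 2) : ‖G z - s * z‖ ≤ 6 * s * ‖z‖ ^ 2 / ρ := by
  have hρC : (ρ : ℂ) ≠ 0 := by exact_mod_cast hρ.ne'
  -- Rogosinski's device: on `|w| = ρ` the factor `(1 - w² / ρ²) / w` equals `-2i Im w / ρ²`, so `Re
  -- H = 2 Im w · Im G / ρ² ≥ 0`. Positivity extends inside, and Borel–Carathéodory for `s - H`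
  -- keeps `H` near `H 0 = s`.
  set H : ℂ → ℂ := fun z => (1 - z ^ 2 / (ρ : ℂ) ^ 2) * dslope G 0 z with hH
  have hHd : DifferentiableOn ℂ H (Metric.ball 0 R) := by
    refine DifferentiableOn.mul (by fun_prop) ?_
    exact (Complex.differentiableOn_dslope (Metric.ball_mem_nhds 0 (hρ.trans hρR))).2 hG
  have hH0 : H 0 = s := by simp [hH, hd]
  have hbdry : ∀ w ∈ frontier (Metric.ball (0 : ℂ) ρ), 0 ≤ (H w).re := by
    intro w hw
    rw [frontier_ball _ hρ.ne', mem_sphere_zero_iff_norm] at hw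
    have hw0 : w ≠ 0 := by rw [← norm_pos_iff, hw]; exact hρ
    have hww : w * (starRingEnd ℂ) w = (ρ : ℂ) ^ 2 := by
      rw [Complex.mul_conj, Complex.normSq_eq_norm_sq, hw]; push_cast; ring
    have h1 : H w = ((2 * w.im / ρ ^ 2 : ℝ) : ℂ) * (-Complex.I * G w) := by
      have h2 : (starRingEnd ℂ) w - w = ((2 * w.im : ℝ) : ℂ) * -Complex.I := by
        apply Complex.ext <;> simp; ring
      have h3 : (1 - w ^ 2 / (ρ : ℂ) ^ 2) * w⁻¹ = ((starRingEnd ℂ) w - w) / (ρ : ℂ) ^ 2 := by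
        rw [← hww]
        have : (starRingEnd ℂ) w ≠ 0 := by simpa using hw0
        field_simp
      rw [hH]
      simp only
      rw [dslope_of_ne _ hw0, slope_def_module, h0, sub_zero, sub_zero, smul_eq_mul,
        ← mul_assoc, h3, h2]
      push_cast; ring
    rw [h1, Complex.re_ofReal_mul]
    have h4 : (-Complex.I * G w).re = (G w).im := by simp
    rw [h4]
    have := hIm w hw
    have h5 : 2 * w.im / ρ ^ 2 * (G w).im = 2 / ρ ^ 2 * (w.im * (G w).im) := by ring
    rw [h5]; positivity
  have hHpos : ∀ w ∈ Metric.ball (0 : ℂ) ρ, 0 ≤ (H w).re := by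
    intro w hw
    have hdc : DiffContOnCl ℂ (fun z => Complex.exp (-H z)) (Metric.ball 0 ρ) := by
      apply DifferentiableOn.diffContOnCl
      refine (hHd.mono ?_).neg.cexp
      rw [closure_ball _ hρ.ne']
      exact Metric.closedBall_subset_ball hρR
    have := Complex.norm_le_of_forall_mem_frontier_norm_le Metric.isBounded_ball hdc (C := 1)
      (fun v hv => by
        rw [Complex.norm_exp, Real.exp_le_one_iff]
        simpa using hbdry v hv) (subset_closure hw)
    rw [Complex.norm_exp, Real.exp_le_one_iff] at this
    simpa using this
  have hzb : z ∈ Metric.ball (0 : ℂ) ρ := by rw [mem_ball_zero_iff]; linarith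
  have hBC : ‖(s : ℂ) - H z‖ ≤ 2 * s * ‖z‖ / (ρ - ‖z‖) := by
    refine Complex.borelCaratheodory_zero (f := fun w => (s : ℂ) - H w) hs
      ((hHd.mono (Metric.ball_subset_ball hρR.le)).const_sub _) ?_ hρ hzb (by simp [hH0])
    intro w hw
    have := hHpos w hw
    simpa using this
  have hBC' : ‖(s : ℂ) - H z‖ ≤ 4 * s * ‖z‖ / ρ := by
    refine hBC.trans ?_
    rw [div_le_div_iff₀ (by linarith) hρ]
    have : 0 ≤ s * ‖z‖ := by positivity
    nlinarith
  have hGz : G z = dslope G 0 z * z := by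
    rcases eq_or_ne z 0 with rfl | hz0
    · simp [h0]
    · rw [dslope_of_ne _ hz0, slope_def_module, h0, sub_zero, sub_zero, smul_eq_mul]
      field_simp
  have hq : ‖z ^ 2 / (ρ : ℂ) ^ 2‖ ≤ 1 / 2 * (‖z‖ / ρ) := by
    rw [norm_div, norm_pow, norm_pow, Complex.norm_real, Real.norm_eq_abs, abs_of_pos hρ,
      ← div_pow, sq]
    apply mul_le_mul_of_nonneg_right _ (by positivity)
    rw [div_le_iff₀ hρ]; linarith
  have hq2 : ‖z‖ / ρ ≤ 1 / 2 := by rw [div_le_iff₀ hρ]; linarith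
  have hlow : 3 / 4 ≤ ‖1 - z ^ 2 / (ρ : ℂ) ^ 2‖ := by
    have := norm_sub_norm_le (1 : ℂ) (z ^ 2 / (ρ : ℂ) ^ 2)
    rw [norm_one] at this
    linarith
  have hid : (1 - z ^ 2 / (ρ : ℂ) ^ 2) * (G z - s * z)
      = z * (-((s : ℂ) - H z) + s * (z ^ 2 / (ρ : ℂ) ^ 2)) := by
    rw [hGz, hH]; ring
  have hnorm : ‖1 - z ^ 2 / (ρ : ℂ) ^ 2‖ * ‖G z - s * z‖
      ≤ ‖z‖ * (4 * s * ‖z‖ / ρ + s * (1 / 2 * (‖z‖ / ρ))) := by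
    rw [← norm_mul, hid, norm_mul]
    refine mul_le_mul_of_nonneg_left ((norm_add_le _ _).trans ?_) (norm_nonneg _)
    rw [norm_neg, norm_mul, Complex.norm_real, Real.norm_eq_abs, abs_of_pos hs]
    gcongr
  have h34 : 3 / 4 * ‖G z - s * z‖ ≤ ‖1 - z ^ 2 / (ρ : ℂ) ^ 2‖ * ‖G z - s * z‖ :=
    mul_le_mul_of_nonneg_right hlow (norm_nonneg _)
  have e : ‖z‖ * (4 * s * ‖z‖ / ρ + s * (1 / 2 * (‖z‖ / ρ))) = 3 / 4 * (6 * s * ‖z‖ ^ 2 / ρ) := by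
    ring
  linarith

/-- Half of the exponent is spent on a factor `t`. With `t = Im w` this makes the error in
`im_deriv_lower_bound` at most `ε Im w`, so it is absorbed by `ε w` even near the real axis. -/
theorem exp_neg_div_le {a t ρ : ℝ} (ha : 0 < a) (ht : 0 < t) (htρ : t ≤ ρ) :
    Real.exp (-(2 * a / t)) ≤ t * (Real.exp (-(a / ρ)) / a) := by
  have h1 : Real.exp (-(a / t)) ≤ t / a := by
    have h2 : a / t ≤ Real.exp (a / t) := by linarith [Real.add_one_le_exp (a / t)]
    rw [Real.exp_neg, inv_le_comm₀ (Real.exp_pos _) (by positivity), inv_div]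
    exact h2
  have h3 : Real.exp (-(a / t)) ≤ Real.exp (-(a / ρ)) := by
    apply Real.exp_le_exp.2
    apply neg_le_neg
    gcongr
  calc Real.exp (-(2 * a / t)) = Real.exp (-(a / t)) * Real.exp (-(a / t)) := by
        rw [← Real.exp_add]; ring_nf
    _ ≤ (t / a) * Real.exp (-(a / ρ)) := by gcongr
    _ = _ := by ring

/-- Stability form of the Marcinkiewicz–Ostrovskii theorem for a zero-free ridge function `exp g`
on a disk: near the origin `g` is close to its quadratic part. -/
theorem norm_sub_quadratic_le_of_ridge {g : ℂ → ℂ} {r ρ S s : ℝ}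
    (hg : DifferentiableOn ℂ g (Metric.ball 0 r)) (h0 : g 0 = 0) (h1 : deriv g 0 = 0)
    (h2 : deriv (deriv g) 0 = s) (hs : 0 < s)
    (hS : ∀ z ∈ Metric.ball (0 : ℂ) (r / 2), ‖deriv g z‖ ≤ S)
    (hsym : ∀ z ∈ Metric.ball (0 : ℂ) r, (g ((starRingEnd ℂ) z)).re = (g z).re)
    (hsym' : ∀ z ∈ Metric.ball (0 : ℂ) r, deriv g ((starRingEnd ℂ) z) = (starRingEnd ℂ) (deriv g z))
    (hridge : ∀ z ∈ Metric.ball (0 : ℂ) r, (g z).re ≤ (g (z.re : ℂ)).re)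
    (hρ : 0 < ρ) (hρr : ρ ≤ r / 16) {z : ℂ} (hz : ‖z‖ ≤ ρ / 2) :
    ‖g z - s * z ^ 2 / 2‖ ≤
      6 * (s + 32 * S * Real.exp (-(Real.pi * r / (32 * ρ))) / r) * ‖z‖ ^ 3 / ρ := by
  have hr : 0 < r := by linarith
  have hpi := Real.pi_pos
  have hS0 : 0 ≤ S := (norm_nonneg _).trans (hS 0 (by simpa using hr))
  set ε : ℝ := 32 * S * Real.exp (-(Real.pi * r / (32 * ρ))) / r with hε
  have hε0 : 0 ≤ ε := by positivity
  have hsub : Metric.ball (0 : ℂ) (r / 2) ⊆ Metric.ball 0 r := Metric.ball_subset_ball (by linarith)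
  have hg' : DifferentiableOn ℂ (deriv g) (Metric.ball 0 r) := hg.deriv Metric.isOpen_ball
  have hlower : ∀ w : ℂ, ‖w‖ = ρ → 0 < w.im → 0 ≤ (deriv g w + ε * w).im := by
    intro w hw him
    have hre : |w.re| ≤ ρ := hw ▸ Complex.abs_re_le_norm w
    have him' : w.im ≤ ρ := hw ▸ (le_abs_self _).trans (Complex.abs_im_le_norm w)
    -- The reflection height is `Im w` itself. As `ρ ≤ r / 16`, one has `X + 2T ≤ 3r / 8 < r / 2`
    -- and `|Re w| ≤ X / 2`.
    have key := im_deriv_lower_bound (g := g) (R := r / 2) (S := S) (X := r / 4) (T := w.im)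
      (x := w.re) (hg.mono hsub) hS (fun z hz => hsym z (hsub hz)) (fun z hz => hsym' z (hsub hz))
      (fun z hz => hridge z (hsub hz)) him (by linarith) (by linarith) (by linarith)
    rw [Complex.re_add_im] at key
    have hexp := exp_neg_div_le (a := Real.pi * r / 32) (by positivity) him him'
    have e1 : Real.pi * (r / 4) / (4 * w.im) = 2 * (Real.pi * r / 32) / w.im := by
      field_simp; ring
    have e2 : Real.pi * r / 32 / ρ = Real.pi * r / (32 * ρ) := by field_simp
    rw [e1] at key
    rw [e2] at hexp
    have h3 : Real.pi * S * Real.exp (-(2 * (Real.pi * r / 32) / w.im)) ≤ ε * w.im := by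
      calc _ ≤ Real.pi * S * (w.im * (Real.exp (-(Real.pi * r / (32 * ρ))) / (Real.pi * r / 32))) :=
            mul_le_mul_of_nonneg_left hexp (by positivity)
        _ = ε * w.im := by rw [hε]; field_simp
    rw [Complex.add_im, Complex.im_ofReal_mul]
    linarith
  have hballρ : ∀ w : ℂ, ‖w‖ = ρ → w ∈ Metric.ball (0 : ℂ) r := fun w hw => by
    rw [mem_ball_zero_iff, hw]; linarith
  have hIm : ∀ w : ℂ, ‖w‖ = ρ → 0 ≤ w.im * (deriv g w + ε * w).im := by
    intro w hw
    rcases lt_trichotomy w.im 0 with h | h | h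
    · have hc := hlower ((starRingEnd ℂ) w) (by simpa using hw) (by simpa using h)
      rw [hsym' w (hballρ w hw)] at hc
      have : (starRingEnd ℂ) (deriv g w) + ε * (starRingEnd ℂ) w
          = (starRingEnd ℂ) (deriv g w + ε * w) := by simp
      rw [this, Complex.conj_im] at hc
      exact mul_nonneg_of_nonpos_of_nonpos h.le (by linarith)
    · simp [h]
    · exact mul_nonneg h.le (hlower w hw h)
  have hGd : DifferentiableOn ℂ (fun w => deriv g w + ε * w) (Metric.ball 0 r) :=
    hg'.add (by fun_prop)
  have hd0 : deriv (fun w => deriv g w + ε * w) 0 = ((s + ε : ℝ) : ℂ) := by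
    have h3 : DifferentiableAt ℂ (deriv g) 0 :=
      hg'.differentiableAt (Metric.ball_mem_nhds 0 hr)
    have h4 : HasDerivAt (fun w => deriv g w + ε * w) ((s : ℂ) + ε) 0 := by
      have h5 := h3.hasDerivAt.add ((hasDerivAt_id (0 : ℂ)).const_mul (ε : ℂ))
      rw [h2, mul_one] at h5
      exact h5
    rw [h4.deriv]; push_cast; rfl
  have hlin : ∀ w : ℂ, ‖w‖ ≤ ρ / 2 → ‖deriv g w - s * w‖ ≤ 6 * (s + ε) * ‖w‖ ^ 2 / ρ := by
    intro w hw
    have := norm_sub_linear_le_of_typicallyReal hGd hρ (by linarith) (by simp [h1])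
      (by linarith : 0 < s + ε) hd0 hIm hw
    refine le_trans (le_of_eq ?_) this
    congr 1; push_cast; ring
  have hzr : Metric.closedBall (0 : ℂ) ‖z‖ ⊆ Metric.ball 0 r :=
    Metric.closedBall_subset_ball (by linarith)
  have hmv := (convex_closedBall (0 : ℂ) ‖z‖).norm_image_sub_le_of_norm_hasDerivWithin_le
    (f := fun w => g w - s * w ^ 2 / 2) (f' := fun w => deriv g w - s * w)
    (C := 6 * (s + ε) * ‖z‖ ^ 2 / ρ) (x := 0) (y := z)
    (fun w hw => by
      have h3 := (hg.differentiableAt (Metric.isOpen_ball.mem_nhds (hzr hw))).hasDerivAt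
      have h4 : HasDerivAt (fun w : ℂ => (s : ℂ) * w ^ 2 / 2) (s * w) w := by
        have := (((hasDerivAt_id w).pow 2).const_mul (s : ℂ)).div_const 2
        convert! this using 1
        simp; ring
      exact (h3.sub h4).hasDerivWithinAt)
    (fun w hw => by
      rw [mem_closedBall_zero_iff] at hw
      refine (hlin w (hw.trans hz)).trans ?_
      have : 0 < s + ε := by linarith
      gcongr)
    (by simp) (by simp)
  simp only [h0, sub_zero] at hmv
  refine le_trans (le_of_eq ?_) (hmv.trans (le_of_eq ?_))
  · congr 1; ring
  · ring

/-! ### The Fejér kernel and smoothing. -/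

/-- The Fejér kernel, up to normalization. -/
noncomputable def fejerKernel (u : ℝ) : ℝ := 2 * (1 - Real.cos u) / u ^ 2

theorem fejerKernel_nonneg (u : ℝ) : 0 ≤ fejerKernel u := by
  have := Real.cos_le_one u
  unfold fejerKernel
  exact div_nonneg (by linarith) (sq_nonneg u)

theorem fejerKernel_neg (u : ℝ) : fejerKernel (-u) = fejerKernel u := by
  simp [fejerKernel]

theorem measurable_fejerKernel : Measurable fejerKernel := by
  unfold fejerKernel; fun_prop

theorem fejerKernel_le (u : ℝ) : fejerKernel u ≤ 8 * (1 + u ^ 2)⁻¹ := by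
  unfold fejerKernel
  rcases eq_or_ne u 0 with rfl | hu
  · simp
  have hu2 : 0 < u ^ 2 := by positivity
  rw [← div_eq_mul_inv, div_le_div_iff₀ hu2 (by positivity)]
  have h1 := Real.one_sub_sq_div_two_le_cos (x := u)
  have h2 := Real.neg_one_le_cos u
  rcases le_total (u ^ 2) 1 with h | h
  · nlinarith
  · nlinarith

theorem integrable_fejerKernel : Integrable fejerKernel := by
  refine (integrable_inv_one_add_sq.const_mul 8).mono' measurable_fejerKernel.aestronglyMeasurable
    (Filter.Eventually.of_forall fun u => ?_)
  rw [Real.norm_eq_abs, abs_of_nonneg (fejerKernel_nonneg u)]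
  exact fejerKernel_le u

theorem integral_fejerKernel_pos : 0 < ∫ u, fejerKernel u := by
  rw [integral_pos_iff_support_of_nonneg fejerKernel_nonneg integrable_fejerKernel]
  refine lt_of_lt_of_le ?_ (measure_mono (s := Set.Ioo (0 : ℝ) 1) ?_)
  · simp
  · intro u hu
    have h : Real.cos u < Real.cos 0 :=
      Real.cos_lt_cos_of_nonneg_of_le_pi le_rfl (by linarith [hu.2, Real.pi_gt_three]) hu.1
    rw [Real.cos_zero] at h
    have h2 : 0 < u ^ 2 := by have := hu.1; positivity
    exact (div_pos (by linarith) h2).ne'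

theorem exists_fejerKernel_mass : ∃ a : ℝ, 0 < a ∧
    3 / 4 * ∫ u, fejerKernel u ≤ ∫ u in Set.Icc (-a) a, fejerKernel u := by
  have h := (aecover_Icc (μ := (volume : Measure ℝ)) (l := Filter.atTop) (a := fun x : ℝ => -x)
    (b := fun x : ℝ => x) Filter.tendsto_neg_atTop_atBot
    Filter.tendsto_id).integral_tendsto_of_countably_generated integrable_fejerKernel
  have h2 := h.eventually (lt_mem_nhds
    (show 3 / 4 * ∫ u, fejerKernel u < ∫ u, fejerKernel u by
      linarith [integral_fejerKernel_pos]))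
  obtain ⟨a, ha, ha'⟩ := (h2.and (Filter.eventually_gt_atTop 0)).exists
  exact ⟨a, ha', ha.le⟩

theorem fejerKernel_fourier {T y : ℝ} (hT : 0 < T) (hy : y ≠ 0) :
    ∫ v in (-T)..T, ((1 - |v| / T : ℝ) : ℂ) * Complex.exp (Complex.I * v * y) =
      ((T * fejerKernel (T * y) : ℝ) : ℂ) := by
  have hyC : (y : ℂ) ≠ 0 := by exact_mod_cast hy
  have hTC : (T : ℂ) ≠ 0 := by exact_mod_cast hT.ne'
  set c : ℂ := Complex.I * y with hc
  have hc0 : c ≠ 0 := mul_ne_zero Complex.I_ne_zero hyC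
  have hcont : Continuous fun v : ℝ =>
      ((1 - |v| / T : ℝ) : ℂ) * Complex.exp (Complex.I * v * y) := by fun_prop
  rw [← intervalIntegral.integral_add_adjacent_intervals (b := 0)
    (hcont.intervalIntegrable _ _) (hcont.intervalIntegrable _ _)]
  have hexp : ∀ v : ℝ, HasDerivAt (fun v : ℝ => Complex.exp (c * v)) (Complex.exp (c * v) * c) v := by
    intro v
    have h1 : HasDerivAt (fun v : ℂ => Complex.exp (c * v)) (Complex.exp (c * v) * c) (v : ℂ) := by
      simpa using ((hasDerivAt_id (v : ℂ)).const_mul c).cexp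
    exact h1.comp_ofReal
  -- Here `σ = ±1` is the sign of `v`, so one antiderivative serves both halves of the triangle `1 -
  -- |v| / T`.
  have hF : ∀ (σ : ℂ) (v : ℝ), HasDerivAt
      (fun v : ℝ => (1 - σ * v / T) * Complex.exp (c * v) / c + σ / T * Complex.exp (c * v) / c ^ 2)
      ((1 - σ * v / T) * Complex.exp (c * v)) v := by
    intro σ v
    have h1 : HasDerivAt (fun v : ℝ => (1 - σ * v / T : ℂ)) (-(σ / T)) v := by
      have := ((hasDerivAt_id (v : ℂ)).comp_ofReal.const_mul σ).div_const (T : ℂ)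
      simpa using this.const_sub 1
    have h2 := ((h1.mul (hexp v)).div_const c).add (((hexp v).const_mul (σ / T)).div_const (c ^ 2))
    convert! h2 using 1
    field_simp
    ring
  have hint : ∀ σ : ℂ, Continuous fun v : ℝ => (1 - σ * v / T) * Complex.exp (c * v) := by
    intro σ; fun_prop
  have e1 : ∫ v in (-T)..0, ((1 - |v| / T : ℝ) : ℂ) * Complex.exp (Complex.I * v * y)
      = ∫ v in (-T)..0, (1 - (-1) * v / T) * Complex.exp (c * v) := by
    apply intervalIntegral.integral_congr
    intro v hv
    rw [Set.uIcc_of_le (by linarith)] at hv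
    simp only
    rw [abs_of_nonpos hv.2, hc]
    push_cast
    ring_nf
  have e2 : ∫ v in (0)..T, ((1 - |v| / T : ℝ) : ℂ) * Complex.exp (Complex.I * v * y)
      = ∫ v in (0)..T, (1 - 1 * v / T) * Complex.exp (c * v) := by
    apply intervalIntegral.integral_congr
    intro v hv
    rw [Set.uIcc_of_le hT.le] at hv
    simp only
    rw [abs_of_nonneg hv.1, hc]
    push_cast
    ring_nf
  rw [e1, e2, intervalIntegral.integral_eq_sub_of_hasDerivAt (fun v _ => hF (-1) v)
    ((hint _).intervalIntegrable _ _), intervalIntegral.integral_eq_sub_of_hasDerivAt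
    (fun v _ => hF 1 v) ((hint _).intervalIntegrable _ _)]
  have hcos : Complex.exp (c * T) + Complex.exp (c * ((-T : ℝ) : ℂ))
      = 2 * ((Real.cos (T * y) : ℝ) : ℂ) := by
    rw [Complex.ofReal_cos, Complex.cos, hc]
    push_cast
    ring_nf
  have hc2 : c ^ 2 = -(y : ℂ) ^ 2 := by rw [hc, mul_pow, Complex.I_sq]; ring
  have hfin : ((T * fejerKernel (T * y) : ℝ) : ℂ)
      = (2 * ((Real.cos (T * y) : ℝ) : ℂ) - 2) / (T * c ^ 2) := by
    rw [hc2, fejerKernel]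
    push_cast
    field_simp
    ring
  rw [hfin, ← hcos]
  push_cast
  field_simp
  simp
  ring

/-- If `Δ x` is large, the one-sided Lipschitz bound keeps `Δ` at least `D` on the window of radius
`a / T` about `x + a / T`. That window carries at least 3/4 of the kernel's mass, and the rest costs
at most `η c / 4`. The resulting coefficient 1/3 of `η` allows absorption when `η` is the supremum.
-/
theorem sup_le_of_smoothing_aux {Δ : ℝ → ℝ} {η m a T I : ℝ} (hΔm : Measurable Δ)
    (hη : ∀ x, |Δ x| ≤ η) (hlip : ∀ x s, 0 ≤ s → Δ x - m * s ≤ Δ (x + s))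
    (hm : 0 ≤ m) (hT : 0 < T)
    (hmass : 3 / 4 * ∫ u, fejerKernel u ≤ ∫ u in Set.Icc (-a) a, fejerKernel u)
    (hI : ∀ x, |∫ u, Δ (x - u / T) * fejerKernel u| ≤ I) (x : ℝ) :
    Δ x ≤ 2 * m * a / T + 4 / (3 * ∫ u, fejerKernel u) * I + η / 3 := by
  set c := ∫ u, fejerKernel u with hc
  have hc0 : 0 < c := integral_fejerKernel_pos
  have hη0 : 0 ≤ η := (abs_nonneg _).trans (hη 0)
  have hI0 : 0 ≤ I := (abs_nonneg _).trans (hI 0)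
  set D := Δ x - 2 * m * a / T with hD
  rcases le_or_gt D 0 with hD0 | hD0
  · have : 0 ≤ 4 / (3 * c) * I := by positivity
    linarith
  set p := ∫ u in Set.Icc (-a) a, fejerKernel u with hp
  have hsplit := integral_add_compl (s := Set.Icc (-a) a) measurableSet_Icc integrable_fejerKernel
  set τ := ∫ u in (Set.Icc (-a) a)ᶜ, fejerKernel u with hτ
  have hint : Integrable fun u => Δ (x + a / T - u / T) * fejerKernel u := by
    refine integrable_fejerKernel.bdd_mul (c := η) ?_ ?_
    · exact (hΔm.comp (by fun_prop)).aestronglyMeasurable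
    · exact Filter.Eventually.of_forall fun u => hη _
  have hsplit2 := integral_add_compl (s := Set.Icc (-a) a) measurableSet_Icc hint
  have h1 : D * p ≤ ∫ u in Set.Icc (-a) a, Δ (x + a / T - u / T) * fejerKernel u := by
    rw [hp, ← integral_const_mul]
    refine setIntegral_mono_on (integrable_fejerKernel.integrableOn.const_mul _)
      hint.integrableOn measurableSet_Icc fun u hu => ?_
    apply mul_le_mul_of_nonneg_right _ (fejerKernel_nonneg u)
    have h2 := hlip x ((a - u) / T) (div_nonneg (by linarith [hu.2]) hT.le)
    have h3 : m * ((a - u) / T) ≤ 2 * m * a / T := by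
      rw [mul_div_assoc', div_le_div_iff_of_pos_right hT]
      nlinarith [hu.1]
    have e : x + a / T - u / T = x + (a - u) / T := by ring
    rw [e]; linarith
  have h2 : -(η * τ) ≤ ∫ u in (Set.Icc (-a) a)ᶜ, Δ (x + a / T - u / T) * fejerKernel u := by
    rw [hτ, ← integral_const_mul, ← integral_neg]
    refine setIntegral_mono_on (integrable_fejerKernel.integrableOn.const_mul _).neg
      hint.integrableOn measurableSet_Icc.compl fun u hu => ?_
    have := (abs_le.1 (hη (x + a / T - u / T))).1
    have := mul_le_mul_of_nonneg_right this (fejerKernel_nonneg u)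
    linarith
  have h3 := (abs_le.1 (hI (x + a / T))).2
  have h4 : D * (3 / 4 * c) ≤ D * p := mul_le_mul_of_nonneg_left hmass hD0.le
  have h5 : η * τ ≤ η * (c / 4) := mul_le_mul_of_nonneg_left (by linarith) hη0
  have h6 : D * (3 / 4 * c) ≤ I + η * (c / 4) := by linarith
  have h7 : D ≤ 4 / (3 * c) * I + η / 3 := by
    have : D = D * (3 / 4 * c) * (4 / (3 * c)) := by field_simp
    rw [this]
    refine (mul_le_mul_of_nonneg_right h6 (by positivity)).trans (le_of_eq ?_)
    field_simp
  linarith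

theorem sup_le_of_smoothing {Δ : ℝ → ℝ} {η m a T I : ℝ} (hΔm : Measurable Δ)
    (hη : ∀ x, |Δ x| ≤ η) (hlip : ∀ x s, 0 ≤ s → Δ x - m * s ≤ Δ (x + s))
    (hm : 0 ≤ m) (hT : 0 < T)
    (hmass : 3 / 4 * ∫ u, fejerKernel u ≤ ∫ u in Set.Icc (-a) a, fejerKernel u)
    (hI : ∀ x, |∫ u, Δ (x - u / T) * fejerKernel u| ≤ I) (x : ℝ) :
    |Δ x| ≤ 2 * m * a / T + 4 / (3 * ∫ u, fejerKernel u) * I + η / 3 := by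
  rw [abs_le']
  refine ⟨sup_le_of_smoothing_aux hΔm hη hlip hm hT hmass hI x, ?_⟩
  have := sup_le_of_smoothing_aux (Δ := fun y => -Δ (-y)) (η := η) (I := I)
    (hΔm.comp measurable_neg).neg (fun y => by rw [abs_neg]; exact hη _)
    (fun y s hs => by
      have := hlip (-(y + s)) s hs
      have e : -(y + s) + s = -y := by ring
      rw [e] at this; linarith) hm hT hmass
    (fun y => by
      have h := hI (-y)
      rw [← integral_neg_eq_self (fun u => Δ (-y - u / T) * fejerKernel u)] at h
      rw [← abs_neg, ← integral_neg]
      refine le_trans (le_of_eq ?_) h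
      congr 2
      ext u
      rw [fejerKernel_neg]
      have e : -(y - u / T) = -y - -u / T := by ring
      rw [e]; ring) (-x)
  simpa using this

/-! ### Fourier transform of a difference of distribution functions; Esseen's inequality. -/

/-- The oriented indicator `1_{y ≤ x} - 1_{0 ≤ x}`. -/
noncomputable def orientedStep (x y : ℝ) : ℝ :=
  (Set.Ico y 0).indicator 1 x - (Set.Ico 0 y).indicator 1 x

theorem orientedStep_eq (x y : ℝ) :
    orientedStep x y = (Set.Iic x).indicator 1 y - (Set.Ici 0).indicator 1 x := by
  unfold orientedStep
  simp only [Set.indicator_apply, Set.mem_Ico, Set.mem_Iic, Set.mem_Ici, Pi.one_apply]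
  rcases le_or_gt 0 x with h | h <;> rcases le_or_gt y x with h' | h' <;>
    simp [h, h', not_lt.2, not_le.2]

theorem measurable_orientedStep : Measurable (Function.uncurry orientedStep) := by
  have : Function.uncurry orientedStep = fun p : ℝ × ℝ =>
      ({q : ℝ × ℝ | q.2 ≤ q.1}.indicator 1 p : ℝ) - ({q : ℝ × ℝ | 0 ≤ q.1}.indicator 1 p : ℝ) := by
    ext ⟨x, y⟩
    simp [Function.uncurry, orientedStep_eq, Set.indicator_apply]
  rw [this]
  exact (measurable_const.indicator (measurableSet_le measurable_snd measurable_fst)).sub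
    (measurable_const.indicator (measurableSet_le measurable_const measurable_fst))

theorem integrable_orientedStep (y : ℝ) : Integrable fun x => orientedStep x y := by
  unfold orientedStep
  have h : ∀ a b : ℝ, Integrable ((Set.Ico a b).indicator (1 : ℝ → ℝ)) := fun a b =>
    (integrable_indicator_iff measurableSet_Ico).2 (integrableOn_const (C := (1 : ℝ)) (by simp))
  exact (h y 0).sub (h 0 y)

/-- Subtracting the Heaviside step makes the indicator integrable in `x`, with norm `|y|`; a first
moment therefore suffices for Fubini. -/
theorem integral_norm_orientedStep (y : ℝ) : ∫ x, ‖orientedStep x y‖ = |y| := by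
  rcases le_total 0 y with h | h
  · have : (fun x => ‖orientedStep x y‖) = (Set.Ico 0 y).indicator 1 := by
      ext x
      simp only [orientedStep, Set.Ico_eq_empty (not_lt.2 h), Set.indicator_empty, zero_sub, norm_neg]
      rw [Set.indicator_apply]; split_ifs <;> simp
    rw [this, integral_indicator_one measurableSet_Ico]
    simp [h, abs_of_nonneg h]
  · have : (fun x => ‖orientedStep x y‖) = (Set.Ico y 0).indicator 1 := by
      ext x
      simp only [orientedStep, Set.Ico_eq_empty (not_lt.2 h), Set.indicator_empty, sub_zero]
      rw [Set.indicator_apply]; split_ifs <;> simp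
    rw [this, integral_indicator_one measurableSet_Ico]
    simp [h, abs_of_nonpos h]

theorem integral_orientedStep_mul_exp (y : ℝ) {t : ℝ} (ht : t ≠ 0) :
    ∫ x, (orientedStep x y : ℂ) * Complex.exp (Complex.I * t * x) =
      (1 - Complex.exp (Complex.I * t * y)) / (Complex.I * t) := by
  have hc : Complex.I * (t : ℂ) ≠ 0 := mul_ne_zero Complex.I_ne_zero (by exact_mod_cast ht)
  have h := integral_exp_mul_complex (a := 0) (b := y) hc
  have e : (fun x : ℝ => (orientedStep x y : ℂ) * Complex.exp (Complex.I * t * x)) = fun x : ℝ =>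
      (Set.Ico y 0).indicator (fun x : ℝ => Complex.exp (Complex.I * t * x)) x -
      (Set.Ico 0 y).indicator (fun x : ℝ => Complex.exp (Complex.I * t * x)) x := by
    ext x
    simp only [orientedStep, Set.indicator_apply, Pi.one_apply]
    split_ifs <;> simp
  have hcont : Continuous fun x : ℝ => Complex.exp (Complex.I * t * x) := by fun_prop
  have hI : ∀ a b : ℝ, IntegrableOn (fun x : ℝ => Complex.exp (Complex.I * t * x)) (Set.Ico a b) :=
    fun a b => (hcont.integrableOn_Icc).mono_set Set.Ico_subset_Icc_self
  rw [e, integral_sub ((hI y 0).integrable_indicator measurableSet_Ico)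
    ((hI 0 y).integrable_indicator measurableSet_Ico), integral_indicator measurableSet_Ico,
    integral_indicator measurableSet_Ico, integral_Ico_eq_integral_Ioc,
    integral_Ico_eq_integral_Ioc]
  rw [intervalIntegral] at h
  rw [← neg_sub, h]
  simp
  ring

theorem abs_cdf_sub_le_one (μ ν : Measure ℝ) (x : ℝ) : |cdf μ x - cdf ν x| ≤ 1 := by
  have h1 := cdf_nonneg μ x
  have h2 := cdf_le_one μ x
  have h3 := cdf_nonneg ν x
  have h4 := cdf_le_one ν x
  rw [abs_le]; constructor <;> linarith

theorem bddAbove_range_abs_cdf_sub (μ ν : Measure ℝ) : BddAbove (Set.range fun x => |cdf μ x - cdf ν x|) :=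
  ⟨1, by rintro _ ⟨x, rfl⟩; exact abs_cdf_sub_le_one μ ν x⟩

theorem ksDist_le_one (μ ν : Measure ℝ) : ksDist μ ν ≤ 1 := ciSup_le fun x => abs_cdf_sub_le_one μ ν x

theorem ksDist_triangle (μ ν κ : Measure ℝ) :
    ksDist μ κ ≤ ksDist μ ν + ksDist ν κ := by
  refine ciSup_le fun x => ?_
  have h1 := le_ciSup (bddAbove_range_abs_cdf_sub μ ν) x
  have h2 := le_ciSup (bddAbove_range_abs_cdf_sub ν κ) x
  exact (abs_sub_le _ (cdf ν x) _).trans (add_le_add h1 h2)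

section CDF

variable {μ ν : Measure ℝ} [IsProbabilityMeasure μ] [IsProbabilityMeasure ν]

theorem integrable_orientedStep_prod (hμ : Integrable id μ) :
    Integrable (Function.uncurry orientedStep) ((volume : Measure ℝ).prod μ) := by
  rw [integrable_prod_iff' measurable_orientedStep.aestronglyMeasurable]
  refine ⟨Filter.Eventually.of_forall integrable_orientedStep, ?_⟩
  simp only [Function.uncurry, integral_norm_orientedStep]
  exact hμ.abs

theorem integral_orientedStep_eq_cdf (x : ℝ) :
    ∫ y, orientedStep x y ∂μ = cdf μ x - (Set.Ici (0 : ℝ)).indicator 1 x := by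
  simp only [orientedStep_eq]
  rw [integral_sub, integral_indicator_one measurableSet_Iic, cdf_eq_real]
  · simp
  · exact (integrable_const (1 : ℝ)).indicator measurableSet_Iic
  · exact integrable_const _

theorem cdf_sub_eq (x : ℝ) :
    cdf μ x - cdf ν x = ∫ y, orientedStep x y ∂μ - ∫ y, orientedStep x y ∂ν := by
  rw [integral_orientedStep_eq_cdf, integral_orientedStep_eq_cdf]; ring

theorem integrable_cdf_sub (hμ : Integrable id μ) (hν : Integrable id ν) :
    Integrable fun x => cdf μ x - cdf ν x := by
  simp only [cdf_sub_eq]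
  exact (integrable_orientedStep_prod hμ).integral_prod_left.sub
    (integrable_orientedStep_prod hν).integral_prod_left

theorem fourier_orientedStep (hμ : Integrable id μ) {t : ℝ} (ht : t ≠ 0) :
    ∫ x, ((∫ y, orientedStep x y ∂μ : ℝ) : ℂ) * Complex.exp (Complex.I * t * x) =
      (1 - charFun μ t) / (Complex.I * t) := by
  have hint : Integrable (Function.uncurry fun (x y : ℝ) =>
      (orientedStep x y : ℂ) * Complex.exp (Complex.I * t * x)) ((volume : Measure ℝ).prod μ) := by
    refine (integrable_orientedStep_prod hμ).ofReal.mul_bdd (c := 1) ?_ ?_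
    · exact Measurable.aestronglyMeasurable (by fun_prop)
    · refine Filter.Eventually.of_forall fun p => ?_
      rw [Complex.norm_exp]; simp
  calc _ = ∫ x, ∫ y, (orientedStep x y : ℂ) * Complex.exp (Complex.I * t * x) ∂μ := by
        congr 1; ext x
        rw [integral_mul_const, integral_complex_ofReal]
    _ = ∫ y, (∫ x, (orientedStep x y : ℂ) * Complex.exp (Complex.I * t * x)) ∂μ :=
        integral_integral_swap hint
    _ = ∫ y, (1 - Complex.exp (Complex.I * t * y)) / (Complex.I * t) ∂μ := by
        congr 1; ext y; exact integral_orientedStep_mul_exp y ht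
    _ = _ := by
        have hi : Integrable (fun y : ℝ => Complex.exp (Complex.I * t * y)) μ := by
          refine (integrable_const (1 : ℝ)).mono' (Continuous.aestronglyMeasurable (by fun_prop)) ?_
          refine Filter.Eventually.of_forall fun p => ?_
          rw [Complex.norm_exp]; simp
        rw [integral_div, integral_sub (integrable_const _) hi, charFun_apply_real]
        simp [mul_comm, mul_left_comm]

theorem fourier_cdf_sub (hμ : Integrable id μ) (hν : Integrable id ν) {t : ℝ} (ht : t ≠ 0) :
    ∫ x, ((cdf μ x - cdf ν x : ℝ) : ℂ) * Complex.exp (Complex.I * t * x) =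
      (charFun ν t - charFun μ t) / (Complex.I * t) := by
  have hb : ∀ {ν : Measure ℝ} [IsProbabilityMeasure ν], Integrable id ν →
      Integrable fun x : ℝ => ((∫ y, orientedStep x y ∂ν : ℝ) : ℂ) *
        Complex.exp (Complex.I * t * x) := by
    intro ν _ h
    refine (integrable_orientedStep_prod h).integral_prod_left.ofReal.mul_bdd (c := 1) ?_ ?_
    · exact Measurable.aestronglyMeasurable (by fun_prop)
    · refine Filter.Eventually.of_forall fun p => ?_
      rw [Complex.norm_exp]; simp
  have e : ∀ x : ℝ, ((cdf μ x - cdf ν x : ℝ) : ℂ) * Complex.exp (Complex.I * t * x) =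
      ((∫ y, orientedStep x y ∂μ : ℝ) : ℂ) * Complex.exp (Complex.I * t * x) -
      ((∫ y, orientedStep x y ∂ν : ℝ) : ℂ) * Complex.exp (Complex.I * t * x) := by
    intro x; rw [cdf_sub_eq]; push_cast; ring
  simp only [e]
  rw [integral_sub (hb hμ) (hb hν), fourier_orientedStep hμ ht, fourier_orientedStep hν ht]
  ring

theorem abs_smoothed_cdf_sub_le (hμ : Integrable id μ) (hν : Integrable id ν) {T : ℝ} (hT : 0 < T)
    {q : ℝ → ℝ} (hq : Integrable q) (hq0 : ∀ u, 0 ≤ q u)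
    (hbd : ∀ u, |u| ≤ T → ‖charFun μ u - charFun ν u‖ ≤ |u| * q u) (x : ℝ) :
    |∫ u, (cdf μ (x - u / T) - cdf ν (x - u / T)) * fejerKernel u| ≤ ∫ u, q u := by
  set Δ : ℝ → ℝ := fun x => cdf μ x - cdf ν x with hΔ
  have hΔi : Integrable Δ := integrable_cdf_sub hμ hν
  have hΔx : Integrable fun y => Δ (x - y) := hΔi.comp_sub_left x
  have hsub : ∫ u, Δ (x - u / T) * fejerKernel u
      = ∫ y, Δ (x - y) * (T * fejerKernel (T * y)) := by
    have := Measure.integral_comp_mul_left (fun u => Δ (x - u / T) * fejerKernel u) T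
    rw [abs_of_pos (inv_pos.2 hT), smul_eq_mul, inv_mul_eq_div, eq_div_iff hT.ne', mul_comm] at this
    rw [← this, ← integral_const_mul]
    congr 1; ext y
    have : x - T * y / T = x - y := by field_simp
    rw [this]; ring
  have hrep : ((∫ y, Δ (x - y) * (T * fejerKernel (T * y)) : ℝ) : ℂ)
      = ∫ y, ∫ v in Set.Ioc (-T) T,
        (Δ (x - y) : ℂ) * (((1 - |v| / T : ℝ) : ℂ) * Complex.exp (Complex.I * v * y)) := by
    rw [← integral_complex_ofReal]
    apply integral_congr_ae
    have : ∀ᵐ y : ℝ, y ≠ 0 := by simp [ae_iff]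
    filter_upwards [this] with y hy
    rw [integral_const_mul, ← intervalIntegral.integral_of_le (by linarith),
      fejerKernel_fourier hT hy]
    push_cast; rfl
  have hw : IntegrableOn (fun v : ℝ => ((1 - |v| / T : ℝ) : ℂ)) (Set.Ioc (-T) T) :=
    (Continuous.integrableOn_Icc (by fun_prop)).mono_set Set.Ioc_subset_Icc_self
  have hprod : Integrable (Function.uncurry fun (y v : ℝ) =>
      (Δ (x - y) : ℂ) * (((1 - |v| / T : ℝ) : ℂ) * Complex.exp (Complex.I * v * y)))
      ((volume : Measure ℝ).prod (volume.restrict (Set.Ioc (-T) T))) := by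
    have h1 := (hΔx.ofReal (𝕜 := ℂ)).mul_prod hw
    have h2 := h1.mul_bdd (c := 1) (g := fun p : ℝ × ℝ => Complex.exp (Complex.I * p.2 * p.1))
      (Measurable.aestronglyMeasurable (by fun_prop))
      (Filter.Eventually.of_forall fun p => by rw [Complex.norm_exp]; simp)
    refine h2.congr (Filter.Eventually.of_forall fun p => ?_)
    simp [Function.uncurry, mul_assoc]
  rw [hsub, ← Real.norm_eq_abs, ← Complex.norm_real, hrep, integral_integral_swap hprod]
  have hq' : Integrable fun v => q (-v) := hq.comp_neg
  have hle : ‖∫ v in Set.Ioc (-T) T, ∫ y, (Δ (x - y) : ℂ) *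
      (((1 - |v| / T : ℝ) : ℂ) * Complex.exp (Complex.I * v * y))‖
      ≤ ∫ v in Set.Ioc (-T) T, q (-v) := by
    refine norm_integral_le_of_norm_le hq'.integrableOn ?_
    have h0 : ∀ᵐ v : ℝ ∂(volume.restrict (Set.Ioc (-T) T)), v ≠ 0 :=
      ae_restrict_of_ae (by simp [ae_iff])
    filter_upwards [h0, ae_restrict_mem measurableSet_Ioc] with v hv hvT
    have hvabs : |v| ≤ T := abs_le.2 ⟨hvT.1.le, hvT.2⟩
    -- Convolution becomes multiplication, with the transform taken at `-v`; hence `q (-v)` in the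
    -- bound.
    have e1 : ∫ y, (Δ (x - y) : ℂ) * (((1 - |v| / T : ℝ) : ℂ) * Complex.exp (Complex.I * v * y))
        = ((1 - |v| / T : ℝ) : ℂ) * (Complex.exp (Complex.I * v * x) *
          ∫ y, (Δ y : ℂ) * Complex.exp (Complex.I * (-v : ℝ) * y)) := by
      rw [← integral_sub_left_eq_self (fun y => (Δ y : ℂ) * Complex.exp (Complex.I * (-v : ℝ) * y))
        volume x, ← integral_const_mul, ← integral_const_mul]
      congr 1; ext y
      have : Complex.exp (Complex.I * v * y) = Complex.exp (Complex.I * v * x) *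
          Complex.exp (Complex.I * (-v : ℝ) * ((x - y : ℝ) : ℂ)) := by
        rw [← Complex.exp_add]; congr 1; push_cast; ring
      rw [this]; ring
    rw [e1, fourier_cdf_sub hμ hν (neg_ne_zero.2 hv), norm_mul, norm_mul, norm_div, norm_mul,
      Complex.norm_I, one_mul, Complex.norm_real, Complex.norm_real, Complex.norm_exp]
    have h2 : ‖(1 - |v| / T : ℝ)‖ ≤ 1 := by
      rw [Real.norm_eq_abs, abs_le]
      have h3 : |v| / T ≤ 1 := (div_le_one hT).2 hvabs
      have h4 : 0 ≤ |v| / T := by positivity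
      constructor <;> linarith
    have h3 : ‖charFun ν (-v) - charFun μ (-v)‖ / ‖(-v : ℝ)‖ ≤ q (-v) := by
      rw [div_le_iff₀ (norm_pos_iff.2 (neg_ne_zero.2 hv)), norm_sub_rev, mul_comm]
      exact hbd (-v) (by rwa [abs_neg])
    have h4 : (Complex.I * v * x : ℂ).re = 0 := by simp
    rw [h4, Real.exp_zero, one_mul]
    calc _ ≤ 1 * q (-v) := mul_le_mul h2 h3 (by positivity) zero_le_one
      _ = q (-v) := one_mul _
  refine hle.trans ?_
  rw [← integral_neg_eq_self q]
  exact setIntegral_le_integral hq' (Filter.Eventually.of_forall fun v => hq0 _)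

end CDF

/-- **Esseen's smoothing inequality**. -/
theorem exists_esseen_smoothing_const : ∃ C : ℝ, 0 < C ∧
    ∀ (μ ν : Measure ℝ) [IsProbabilityMeasure μ] [IsProbabilityMeasure ν],
      Integrable id μ → Integrable id ν → ∀ (m T : ℝ) (q : ℝ → ℝ), 0 ≤ m → 0 < T →
      (∀ x s, 0 ≤ s → cdf ν (x + s) ≤ cdf ν x + m * s) → Integrable q → (∀ u, 0 ≤ q u) →
      (∀ u, |u| ≤ T → ‖charFun μ u - charFun ν u‖ ≤ |u| * q u) →
      ksDist μ ν ≤ C * ((∫ u, q u) + m / T) := by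
  obtain ⟨a, ha, hmass⟩ := exists_fejerKernel_mass
  have hc0 := integral_fejerKernel_pos
  set c := ∫ u, fejerKernel u
  -- Moving `η / 3` to the left multiplies the coefficients `2a` and `4 / (3c)` by 3/2.
  refine ⟨3 * a + 2 / c, by positivity, ?_⟩
  intro μ ν _ _ hμ hν m T q hm hT hlip hq hq0 hbd
  have hqi : 0 ≤ ∫ u, q u := integral_nonneg hq0
  have hx := sup_le_of_smoothing (Δ := fun x => cdf μ x - cdf ν x) (η := ksDist μ ν)
    ((monotone_cdf μ).measurable.sub (monotone_cdf ν).measurable)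
    (fun x => le_ciSup (bddAbove_range_abs_cdf_sub μ ν) x)
    (fun x s hs => by
      have h1 := hlip x s hs
      have h2 := monotone_cdf μ (by linarith : x ≤ x + s)
      linarith) hm hT hmass (fun x => abs_smoothed_cdf_sub_le hμ hν hT hq hq0 hbd x)
  have h := ciSup_le hx
  change ksDist μ ν ≤ _ at h
  have h2 : ksDist μ ν ≤ 3 * a * (m / T) + 2 / c * ∫ u, q u := by
    have e1 : 2 * m * a / T = 2 * a * (m / T) := by ring
    have e2 : 4 / (3 * c) * (∫ u, q u) = 2 / 3 * (2 / c * ∫ u, q u) := by field_simp; ring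
    rw [e1, e2] at h
    linarith
  have h3 : 0 ≤ m / T := by positivity
  have h4 : 0 ≤ 2 / c := by positivity
  nlinarith [mul_nonneg h4 h3, mul_nonneg ha.le hqi]

/-! ### Gaussian comparisons. -/

theorem cdf_gaussianReal_le_add {v : NNReal} (hv : v ≠ 0) {x y D : ℝ} (hxy : x ≤ y)
    (hD : ∀ t ∈ Set.Ioc x y, gaussianPDFReal 0 v t ≤ D) :
    cdf (gaussianReal 0 v) y ≤ cdf (gaussianReal 0 v) x + D * (y - x) := by
  rw [cdf_eq_real, cdf_eq_real, ← Set.Iic_union_Ioc_eq_Iic hxy,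
    measureReal_union (Set.Iic_disjoint_Ioc le_rfl) measurableSet_Ioc]
  have h0 : 0 ≤ ∫ t in Set.Ioc x y, gaussianPDFReal 0 v t :=
    integral_nonneg fun t => gaussianPDFReal_nonneg _ _ _
  have h1 : (gaussianReal 0 v).real (Set.Ioc x y) = ∫ t in Set.Ioc x y, gaussianPDFReal 0 v t := by
    rw [measureReal_def, gaussianReal_apply_eq_integral _ hv, ENNReal.toReal_ofReal h0]
  have h2 : ∫ t in Set.Ioc x y, gaussianPDFReal 0 v t ≤ ∫ _ in Set.Ioc x y, D :=
    setIntegral_mono_on (integrable_gaussianPDFReal _ _).integrableOn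
      (integrableOn_const (by simp)) measurableSet_Ioc hD
  rw [setIntegral_const, Real.volume_real_Ioc_of_le hxy, smul_eq_mul, mul_comm] at h2
  linarith

theorem abs_mul_exp_neg_sq_le (p : ℝ) : |p| * Real.exp (-p ^ 2 / 2) ≤ 1 := by
  have h1 : |p| ≤ Real.exp (p ^ 2 / 2) := by
    have h2 := Real.add_one_le_exp (p ^ 2 / 2)
    have h3 := sq_abs p
    nlinarith [sq_nonneg (|p| - 1)]
  calc |p| * Real.exp (-p ^ 2 / 2) ≤ Real.exp (p ^ 2 / 2) * Real.exp (-p ^ 2 / 2) :=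
        mul_le_mul_of_nonneg_right h1 (Real.exp_pos _).le
    _ = 1 := by rw [← Real.exp_add]; ring_nf; simp

theorem inv_sqrt_two_pi_mul_le_one {v : ℝ} (hv : 1 / 4 ≤ v) : (√(2 * Real.pi * v))⁻¹ ≤ 1 := by
  apply inv_le_one_of_one_le₀
  rw [Real.one_le_sqrt]
  nlinarith [Real.pi_gt_three]

/-- Between `p` and `k p` the density is at most `exp (-p² / 2)`, the interval has length `(k - 1)
|p|`, and `|p| exp (-p² / 2) ≤ 1`. -/
theorem abs_cdf_gaussianReal_mul_sub_le {k : ℝ} (hk : 1 ≤ k) (p : ℝ) :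
    |cdf (gaussianReal 0 1) (k * p) - cdf (gaussianReal 0 1) p| ≤ k - 1 := by
  have hpdf : ∀ t : ℝ, |p| ≤ |t| → gaussianPDFReal 0 1 t ≤ Real.exp (-p ^ 2 / 2) := by
    intro t ht
    rw [gaussianPDFReal]
    have h1 := inv_sqrt_two_pi_mul_le_one (v := ((1 : NNReal) : ℝ)) (by norm_num)
    calc _ ≤ 1 * Real.exp (-(t - 0) ^ 2 / (2 * ((1 : NNReal) : ℝ))) :=
          mul_le_mul_of_nonneg_right h1 (Real.exp_pos _).le
      _ ≤ Real.exp (-p ^ 2 / 2) := by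
          rw [one_mul]
          apply Real.exp_le_exp.2
          have := sq_le_sq.2 ht
          simp
          linarith
  have hlen : Real.exp (-p ^ 2 / 2) * ((k - 1) * |p|) ≤ k - 1 := by
    have := mul_le_mul_of_nonneg_left (abs_mul_exp_neg_sq_le p) (by linarith : 0 ≤ k - 1)
    linarith
  rcases le_total 0 p with hp | hp
  · have hle : p ≤ k * p := by nlinarith
    have h := cdf_gaussianReal_le_add one_ne_zero hle (D := Real.exp (-p ^ 2 / 2))
      (fun t ht => hpdf t (by rw [abs_of_nonneg hp, abs_of_nonneg (hp.trans ht.1.le)]; exact ht.1.le))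
    have h2 := monotone_cdf (gaussianReal 0 1) hle
    rw [abs_of_nonneg hp] at hlen
    rw [abs_of_nonneg (by linarith)]
    linarith
  · have hle : k * p ≤ p := by nlinarith
    have h := cdf_gaussianReal_le_add one_ne_zero hle (D := Real.exp (-p ^ 2 / 2))
      (fun t ht => hpdf t (by
        rw [abs_of_nonpos hp, abs_of_nonpos (ht.2.trans hp)]; linarith [ht.2]))
    have h2 := monotone_cdf (gaussianReal 0 1) hle
    rw [abs_of_nonpos hp] at hlen
    rw [abs_of_nonpos (by linarith)]
    linarith

theorem cdf_gaussianReal_sq {σ : ℝ} (hσ : 0 < σ) (x : ℝ) :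
    cdf (gaussianReal 0 (σ ^ 2).toNNReal) x = cdf (gaussianReal 0 1) (x / σ) := by
  have h := gaussianReal_map_const_mul (μ := 0) (v := 1) σ
  have e : (.mk (σ ^ 2) (sq_nonneg _) * 1 : NNReal) = (σ ^ 2).toNNReal := by
    rw [mul_one]; ext; simp [sq_nonneg]
  rw [e, mul_zero] at h
  rw [cdf_eq_real, cdf_eq_real, ← h, map_measureReal_apply (by fun_prop) measurableSet_Iic]
  congr 1
  ext y
  simp only [Set.mem_preimage, Set.mem_Iic]
  rw [le_div_iff₀ hσ, mul_comm]

theorem ksDist_gaussianReal_le {σ : ℝ} (hσ : 1 / 2 ≤ σ) :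
    ksDist (gaussianReal 0 (σ ^ 2).toNNReal) (gaussianReal 0 1) ≤ 2 * |σ - 1| := by
  have hσ0 : 0 < σ := by linarith
  refine ciSup_le fun x => ?_
  rw [cdf_gaussianReal_sq hσ0]
  rcases le_total 1 σ with h | h
  · have := abs_cdf_gaussianReal_mul_sub_le h (x / σ)
    have e : σ * (x / σ) = x := by field_simp
    rw [e, abs_sub_comm] at this
    rw [abs_of_nonneg (by linarith : 0 ≤ σ - 1)]
    linarith
  -- Here `k = 1 / σ`, and `k - 1 = (1 - σ) / σ ≤ 2 (1 - σ)` because `σ ≥ 1/2`; this is the source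
  -- of the factor 2.
  · have := abs_cdf_gaussianReal_mul_sub_le ((one_le_div hσ0).2 h) x
    have e : 1 / σ * x = x / σ := by ring
    rw [e] at this
    refine this.trans ?_
    rw [abs_of_nonpos (by linarith : σ - 1 ≤ 0), div_sub_one hσ0.ne', div_le_iff₀ hσ0]
    nlinarith

/-- Esseen's inequality with cutoff `ρ / (16 K)`: there the cubic error is at most `t² / 16`, half
of the decay `exp (-t² / 8)` given by `σ ≥ 1/2`. What remains after division by `|t|` is `K / ρ`
times the integrable `t² exp (-t² / 16)`. -/
theorem exists_gaussian_approx_const : ∃ C : ℝ, 0 < C ∧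
    ∀ (μ : Measure ℝ) [IsProbabilityMeasure μ], Integrable id μ →
      ∀ (σ ρ K : ℝ) (w : ℝ → ℂ), 1 / 2 ≤ σ → 0 < ρ → 1 ≤ K →
      (∀ t, |t| ≤ ρ / 2 → charFun μ t = Complex.exp (w t)) →
      (∀ t, |t| ≤ ρ / 2 → ‖w t + (σ : ℂ) ^ 2 * t ^ 2 / 2‖ ≤ K * |t| ^ 3 / ρ) →
      ksDist μ (gaussianReal 0 (σ ^ 2).toNNReal) ≤ C * K / ρ := by
  obtain ⟨C, hC, hE⟩ := exists_esseen_smoothing_const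
  have hi : Integrable fun t : ℝ => t ^ 2 * Real.exp (-(1 / 16) * t ^ 2) := by
    have := integrable_rpow_mul_exp_neg_mul_sq (b := 1 / 16) (by norm_num) (s := 2) (by norm_num)
    simpa using this
  set I₀ := ∫ t : ℝ, t ^ 2 * Real.exp (-(1 / 16) * t ^ 2) with hI₀
  have hI₀0 : 0 ≤ I₀ := integral_nonneg fun t => by positivity
  refine ⟨C * (I₀ + 16), by positivity, ?_⟩
  intro μ _ hμ σ ρ K w hσ hρ hK hw hwb
  have hσ2 : 1 / 4 ≤ σ ^ 2 := by nlinarith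
  have hv : (σ ^ 2).toNNReal ≠ 0 := by
    rw [Ne, Real.toNNReal_eq_zero]; linarith
  have hvr : (((σ ^ 2).toNNReal : NNReal) : ℝ) = σ ^ 2 := Real.coe_toNNReal _ (sq_nonneg σ)
  have hT : 0 < ρ / (16 * K) := by positivity
  have hTρ : ρ / (16 * K) ≤ ρ / 2 := by
    apply div_le_div_of_nonneg_left hρ.le two_pos; linarith
  have key := hE μ (gaussianReal 0 (σ ^ 2).toNNReal) hμ
    ((memLp_id_gaussianReal 1).integrable le_rfl) 1 (ρ / (16 * K))
    (fun t => K / ρ * (t ^ 2 * Real.exp (-(1 / 16) * t ^ 2))) zero_le_one hT ?_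
    (hi.const_mul _) (fun t => by positivity) ?_
  · refine key.trans (le_of_eq ?_)
    rw [integral_const_mul, ← hI₀]
    field_simp
  · intro x s hs
    refine (cdf_gaussianReal_le_add hv (D := 1) (by linarith : x ≤ x + s) ?_).trans (by linarith)
    intro t _
    rw [gaussianPDFReal, hvr]
    have h1 := inv_sqrt_two_pi_mul_le_one hσ2
    have h2 : Real.exp (-(t - 0) ^ 2 / (2 * σ ^ 2)) ≤ 1 := by
      rw [Real.exp_le_one_iff]
      exact div_nonpos_of_nonpos_of_nonneg (by nlinarith [sq_nonneg t]) (by positivity)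
    exact mul_le_one₀ h1 (Real.exp_pos _).le h2
  · intro t ht
    have ht2 := ht.trans hTρ
    set a : ℂ := -((σ : ℂ) ^ 2 * t ^ 2 / 2) with ha
    set b : ℂ := w t + (σ : ℂ) ^ 2 * t ^ 2 / 2 with hb
    have hφ : charFun (gaussianReal 0 (σ ^ 2).toNNReal) t = Complex.exp a := by
      rw [charFun_gaussianReal, ha]
      congr 1
      have : (((σ ^ 2).toNNReal : NNReal) : ℂ) = (σ : ℂ) ^ 2 := by
        rw [← Complex.ofReal_pow, ← hvr]; simp
      rw [this]; simp
    have hwab : w t = a + b := by rw [ha, hb]; ring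
    have hb1 : ‖b‖ ≤ K * |t| ^ 3 / ρ := hwb t ht2
    have hb2 : K * |t| ^ 3 / ρ ≤ t ^ 2 / 16 := by
      have h1 : |t| * (16 * K) ≤ ρ := (le_div_iff₀ (by positivity)).1 ht
      rw [div_le_div_iff₀ hρ (by norm_num), ← sq_abs t]
      have := mul_le_mul_of_nonneg_left h1 (sq_nonneg |t|)
      nlinarith
    have hae : ‖Complex.exp a‖ ≤ Real.exp (-(t ^ 2) / 8) := by
      rw [Complex.norm_exp]
      apply Real.exp_le_exp.2
      have : a = ((-(σ ^ 2 * t ^ 2 / 2) : ℝ) : ℂ) := by rw [ha]; push_cast; ring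
      rw [this, Complex.ofReal_re]
      nlinarith [sq_nonneg t]
    have hbe : ‖Complex.exp b - 1‖ ≤ ‖b‖ * Real.exp ‖b‖ := by
      have := Complex.norm_exp_sub_sum_le_norm_mul_exp b 1
      simpa using this
    have e : Complex.exp (a + b) - Complex.exp a = Complex.exp a * (Complex.exp b - 1) := by
      rw [Complex.exp_add]; ring
    rw [hw t ht2, hφ, hwab, e, norm_mul]
    calc ‖Complex.exp a‖ * ‖Complex.exp b - 1‖
        ≤ Real.exp (-(t ^ 2) / 8) * ((K * |t| ^ 3 / ρ) * Real.exp (t ^ 2 / 16)) := by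
          gcongr
          refine hbe.trans ?_
          gcongr
          exact hb1.trans hb2
      _ = K * |t| ^ 3 / ρ * Real.exp (-(1 / 16) * t ^ 2) := by
          rw [mul_left_comm, ← Real.exp_add]; ring_nf
      _ = _ := by rw [← sq_abs t]; ring

/-! ### Holomorphic logarithm and the complex moment generating function. -/

theorem exists_log_on_ball {f : ℂ → ℂ} {r : ℝ} (hr : 0 < r)
    (hf : DifferentiableOn ℂ f (Metric.ball 0 r)) (h0 : f 0 = 1)
    (hne : ∀ z ∈ Metric.ball (0 : ℂ) r, f z ≠ 0) :
    ∃ g : ℂ → ℂ, g 0 = 0 ∧ (∀ z ∈ Metric.ball (0 : ℂ) r, HasDerivAt g (deriv f z / f z) z) ∧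
      ∀ z ∈ Metric.ball (0 : ℂ) r, Complex.exp (g z) = f z := by
  have hd : DifferentiableOn ℂ (fun z => deriv f z / f z) (Metric.ball 0 r) :=
    (hf.deriv Metric.isOpen_ball).div hf hne
  obtain ⟨g, hg0, hg⟩ := hd.isExactOn_ball.with_val_at 0 0
  refine ⟨g, hg0, hg, fun z hz => ?_⟩
  have hder : ∀ w ∈ Metric.ball (0 : ℂ) r, HasDerivAt (fun w => Complex.exp (-g w) * f w) 0 w := by
    intro w hw
    have h1 := (hg w hw).neg.cexp.mul
      (hf.differentiableAt (Metric.isOpen_ball.mem_nhds hw)).hasDerivAt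
    convert! h1 using 1
    have := hne w hw
    field_simp
    ring
  have hconst := (convex_ball (0 : ℂ) r).norm_image_sub_le_of_norm_hasDerivWithin_le (C := 0)
    (fun w hw => (hder w hw).hasDerivWithinAt) (fun w _ => by simp)
    (Metric.mem_ball_self hr) hz
  rw [zero_mul, norm_le_zero_iff, hg0, h0, neg_zero, Complex.exp_zero, mul_one, sub_eq_zero,
    Complex.exp_neg, inv_mul_eq_one₀ (Complex.exp_ne_zero _)] at hconst
  exact hconst

section MGF

variable {Ω : Type*} [MeasurableSpace Ω] {P : Measure Ω} {X : Ω → ℝ} {r : ℝ}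

theorem norm_cexp_mul_le (z : ℂ) (x : ℝ) (hz : ‖z‖ ≤ r) :
    ‖Complex.exp (z * x)‖ ≤ Real.exp (r * |x|) := by
  rw [Complex.norm_exp]
  apply Real.exp_le_exp.2
  rw [Complex.re_mul_ofReal]
  refine (le_abs_self _).trans ?_
  rw [abs_mul]
  exact mul_le_mul_of_nonneg_right ((Complex.abs_re_le_norm z).trans hz) (abs_nonneg x)

theorem continuousOn_complexMGF (hX : AEMeasurable X P)
    (hint : Integrable (fun ω => Real.exp (r * |X ω|)) P) :
    ContinuousOn (complexMGF X P) (Metric.closedBall 0 r) := by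
  refine continuousOn_of_dominated (bound := fun ω => Real.exp (r * |X ω|)) ?_ ?_ hint ?_
  · intro z _
    exact AEMeasurable.aestronglyMeasurable (by fun_prop)
  · intro z hz
    exact Filter.Eventually.of_forall fun ω => norm_cexp_mul_le z _ (mem_closedBall_zero_iff.1 hz)
  · exact Filter.Eventually.of_forall fun ω => by fun_prop

theorem re_mem_interior_integrableExpSet (hX : AEMeasurable X P)
    (hint : Integrable (fun ω => Real.exp (r * |X ω|)) P) {z : ℂ}
    (hz : z ∈ Metric.ball (0 : ℂ) r) : z.re ∈ interior (integrableExpSet X P) := by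
  have hsub : Set.Ioo (-r) r ⊆ integrableExpSet X P := by
    intro t ht
    refine hint.mono' (AEMeasurable.aestronglyMeasurable (by fun_prop))
      (Filter.Eventually.of_forall fun ω => ?_)
    rw [Real.norm_eq_abs, Real.abs_exp]
    apply Real.exp_le_exp.2
    refine (le_abs_self _).trans ?_
    rw [abs_mul]
    exact mul_le_mul_of_nonneg_right (abs_le.2 ⟨ht.1.le, ht.2.le⟩) (abs_nonneg _)
  refine interior_maximal hsub isOpen_Ioo ?_
  have := (Complex.abs_re_le_norm z).trans_lt (mem_ball_zero_iff.1 hz)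
  exact abs_lt.1 this

theorem complexMGF_conj (z : ℂ) :
    complexMGF X P ((starRingEnd ℂ) z) = (starRingEnd ℂ) (complexMGF X P z) := by
  unfold complexMGF
  rw [← integral_conj]
  congr 1
  ext ω
  rw [← Complex.exp_conj]
  simp

theorem deriv_complexMGF_conj (z : ℂ) :
    deriv (complexMGF X P) ((starRingEnd ℂ) z) = (starRingEnd ℂ) (deriv (complexMGF X P) z) := by
  have h : (starRingEnd ℂ) ∘ complexMGF X P ∘ (starRingEnd ℂ) = complexMGF X P := by
    ext w
    simp [complexMGF_conj]
  have h2 := congrFun (deriv_conj_conj (f := complexMGF X P)) ((starRingEnd ℂ) z)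
  rw [h] at h2
  simpa using h2

theorem complexMGF_centered (z : ℂ) :
    complexMGF (centered P X) P z = complexMGF X P z * Complex.exp (-((∫ ω, X ω ∂P : ℝ) * z)) := by
  unfold complexMGF centered
  rw [← integral_mul_const]
  congr 1
  ext ω
  rw [← Complex.exp_add]
  congr 1
  push_cast
  ring

/-- Borel–Carathéodory on `|w| ≤ 3r / 4` gives `|g| ≤ 6B`; Cauchy's estimate on circles of radius `r
/ 4` multiplies this by `4 / r`. -/
theorem norm_deriv_le_of_re_le {g : ℂ → ℂ} {B : ℝ} (hr : 0 < r) (hB : 0 < B)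
    (hg : DifferentiableOn ℂ g (Metric.ball 0 r)) (h0 : g 0 = 0)
    (hre : ∀ z ∈ Metric.ball (0 : ℂ) r, (g z).re ≤ B) {z : ℂ}
    (hz : z ∈ Metric.ball (0 : ℂ) (r / 2)) : ‖deriv g z‖ ≤ 24 * B / r := by
  rw [mem_ball_zero_iff] at hz
  have hsub : Metric.closedBall z (r / 4) ⊆ Metric.ball 0 r := by
    intro w hw
    rw [mem_closedBall_iff_norm] at hw
    rw [mem_ball_zero_iff]
    have := norm_le_norm_add_norm_sub z w
    rw [norm_sub_rev] at hw
    linarith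
  have hdc : DiffContOnCl ℂ g (Metric.ball z (r / 4)) := by
    apply DifferentiableOn.diffContOnCl
    rw [closure_ball _ (by positivity)]
    exact hg.mono hsub
  have := Complex.norm_deriv_le_of_forall_mem_sphere_norm_le (C := 6 * B) (by positivity) hdc
    (fun w hw => by
      have hw1 := hsub (Metric.sphere_subset_closedBall hw)
      rw [mem_sphere_iff_norm] at hw
      have hw2 : ‖w‖ ≤ 3 * r / 4 := by
        have := norm_le_norm_add_norm_sub z w
        rw [norm_sub_rev] at hw
        linarith
      refine (Complex.borelCaratheodory_zero hB hg (fun v hv => hre v hv) hr hw1 h0).trans ?_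
      rw [div_le_iff₀ (by linarith)]
      nlinarith)
  refine this.trans (le_of_eq ?_)
  field_simp
  ring

end MGF

/-! ### The logarithm of the transform, and the theorem. -/

section Main

variable {Ω : Type*} [MeasurableSpace Ω] {P : Measure Ω} [IsProbabilityMeasure P] {X : Ω → ℝ}
  {r M : ℝ}

/-- The logarithm of the moment generating function of the centered variable is close to its
quadratic part. -/
theorem exists_log_complexMGF_centered (hX : AEMeasurable X P) (hr : 1 ≤ r)
    (hint : Integrable (fun ω => Real.exp (r * |X ω|)) P)
    (hne : ∀ z ∈ Metric.ball (0 : ℂ) r, complexMGF X P z ≠ 0) (hM1 : 1 ≤ M)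
    (hM : ∀ z ∈ Metric.ball (0 : ℂ) r, ‖complexMGF X P z‖ ≤ M) (hVar : 0 < variance X P)
    {ρ : ℝ} (hρ : ρ = r / (16 * (1 + Real.posLog (Real.log M)))) :
    ∃ G : ℂ → ℂ, (∀ z ∈ Metric.ball (0 : ℂ) r,
        complexMGF (centered P X) P z = Complex.exp (G z)) ∧
      ∀ z : ℂ, ‖z‖ ≤ ρ / 2 → ‖G z - (variance X P : ℝ) * z ^ 2 / 2‖ ≤
        6 * (variance X P + 1536) * ‖z‖ ^ 3 / ρ := by
  have hr0 : 0 < r := by linarith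
  have hzero : (0 : ℂ) ∈ Metric.ball (0 : ℂ) r := Metric.mem_ball_self hr0
  set m : ℝ := ∫ ω, X ω ∂P with hm
  set f := complexMGF X P with hf
  have hmem : ∀ z ∈ Metric.ball (0 : ℂ) r, z.re ∈ interior (integrableExpSet X P) :=
    fun z hz => re_mem_interior_integrableExpSet hX hint hz
  have hfd : DifferentiableOn ℂ f (Metric.ball 0 r) := differentiableOn_complexMGF.mono hmem
  have hf0 : f 0 = 1 := by simp [hf, complexMGF]
  have hf1 : deriv f 0 = m := by
    rw [(hasDerivAt_complexMGF (hmem 0 hzero)).deriv]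
    simp [hm, integral_complex_ofReal]
  have hf2 : HasDerivAt (deriv f) ((∫ ω, X ω ^ 2 ∂P : ℝ) : ℂ) 0 := by
    have h := hasDerivAt_iteratedDeriv_complexMGF (hmem 0 hzero) 1
    rw [iteratedDeriv_one] at h
    convert! h using 1
    rw [← integral_complex_ofReal]
    simp
  have hvar : variance X P = (∫ ω, X ω ^ 2 ∂P) - m ^ 2 := by
    have h0 : (0 : ℝ) ∈ interior (integrableExpSet X P) := by simpa using hmem 0 hzero
    exact variance_eq_sub (memLp_of_mem_interior_integrableExpSet h0 2)
  obtain ⟨g, hg0, hgd, hge⟩ := exists_log_on_ball hr0 hfd hf0 hne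
  set G : ℂ → ℂ := fun z => g z - m * z with hG
  have hGd : ∀ z ∈ Metric.ball (0 : ℂ) r, HasDerivAt G (deriv f z / f z - m) z := by
    intro z hz
    have h := (hgd z hz).sub ((hasDerivAt_id z).const_mul (m : ℂ))
    rw [mul_one] at h
    exact h
  have hnorm : ∀ z ∈ Metric.ball (0 : ℂ) r, Real.exp (g z).re = ‖f z‖ := by
    intro z hz
    rw [← Complex.norm_exp, hge z hz]
  have hconj : ∀ z ∈ Metric.ball (0 : ℂ) r, (starRingEnd ℂ) z ∈ Metric.ball (0 : ℂ) r := by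
    intro z hz
    simpa using hz
  refine ⟨G, fun z hz => ?_, fun z hz => ?_⟩
  · rw [complexMGF_centered, hG, ← hf, ← hm]
    simp only
    rw [sub_eq_add_neg, Complex.exp_add, hge z hz]
  have hL : 0 ≤ Real.posLog (Real.log M) := Real.posLog_nonneg
  set L : ℝ := 1 + Real.posLog (Real.log M) with hLdef
  set B : ℝ := max 1 (Real.log M) with hB
  have hB1 : 1 ≤ B := le_max_left _ _
  have hexpL : Real.exp (L - 1) = B := by
    rw [hLdef, add_sub_cancel_left, Real.posLog_eq_log_max_one (Real.log_nonneg hM1),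
      Real.exp_log (by linarith)]
  have hgre : ∀ z ∈ Metric.ball (0 : ℂ) r, (g z).re ≤ B := by
    intro z hz
    refine le_trans ?_ (le_max_right _ _)
    rw [Real.le_log_iff_exp_le (by linarith), hnorm z hz]
    exact hM z hz
  have hgdiff : DifferentiableOn ℂ g (Metric.ball 0 r) :=
    fun z hz => (hgd z hz).differentiableAt.differentiableWithinAt
  have hGdiff : DifferentiableOn ℂ G (Metric.ball 0 r) :=
    fun z hz => (hGd z hz).differentiableAt.differentiableWithinAt
  have hg' : ∀ w ∈ Metric.ball (0 : ℂ) (r / 2), ‖deriv f w / f w‖ ≤ 24 * B / r := by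
    intro w hw
    rw [← (hgd w (Metric.ball_subset_ball (by linarith) hw)).deriv]
    exact norm_deriv_le_of_re_le hr0 (by linarith) hgdiff hg0 hgre hw
  have hm' : ‖(m : ℂ)‖ ≤ 24 * B / r := by
    have := hg' 0 (Metric.mem_ball_self (by linarith))
    rwa [hf0, hf1, div_one] at this
  have hS : ∀ w ∈ Metric.ball (0 : ℂ) (r / 2), ‖deriv G w‖ ≤ 48 * B / r := by
    intro w hw
    rw [(hGd w (Metric.ball_subset_ball (by linarith) hw)).deriv]
    refine (norm_sub_le _ _).trans ((add_le_add (hg' w hw) hm').trans (le_of_eq ?_))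
    ring
  have hG1 : deriv G 0 = 0 := by rw [(hGd 0 hzero).deriv, hf0, hf1]; simp
  have hG2 : deriv (deriv G) 0 = (variance X P : ℝ) := by
    have he : deriv G =ᶠ[nhds 0] fun z => deriv f z / f z - m := by
      filter_upwards [Metric.isOpen_ball.mem_nhds hzero] with z hz
      exact (hGd z hz).deriv
    rw [he.deriv_eq]
    have hfd0 := (hfd.differentiableAt (Metric.isOpen_ball.mem_nhds hzero)).hasDerivAt
    have := (hf2.div hfd0 (by rw [hf0]; exact one_ne_zero)).sub_const (m : ℂ)
    refine this.deriv.trans ?_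
    rw [hf0, hf1, hvar]
    push_cast
    ring
  have hρ0 : 0 < ρ := by rw [hρ]; positivity
  have hρr : ρ ≤ r / 16 := by
    rw [hρ]
    apply div_le_div_of_nonneg_left hr0.le (by norm_num)
    linarith
  have key := norm_sub_quadratic_le_of_ridge (ρ := ρ) hGdiff (by simp [hG, hg0]) hG1 hG2 hVar hS
    (fun w hw => by
      have h1 : (g ((starRingEnd ℂ) w)).re = (g w).re := by
        apply Real.exp_injective
        rw [hnorm _ (hconj w hw), hnorm w hw, hf, complexMGF_conj, RCLike.norm_conj]
      simp [hG, h1])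
    (fun w hw => by
      rw [(hGd w hw).deriv, (hGd _ (hconj w hw)).deriv, hf, complexMGF_conj, deriv_complexMGF_conj]
      simp)
    (fun w hw => by
      have hw' : (w.re : ℂ) ∈ Metric.ball (0 : ℂ) r := by
        rw [mem_ball_zero_iff] at hw ⊢
        rw [Complex.norm_real]
        exact (Complex.abs_re_le_norm w).trans_lt hw
      have h1 : (g w).re ≤ (g (w.re : ℂ)).re := by
        rw [← Real.exp_le_exp, hnorm w hw, hnorm _ hw', hf]
        refine norm_complexMGF_le_mgf.trans ?_
        rw [complexMGF_ofReal, Complex.norm_real]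
        exact le_abs_self _
      simpa [hG] using h1)
    hρ0 hρr hz
  refine key.trans ?_
  -- The choice of `ρ` makes the exponent `-π L / 2 ≤ -(L - 1)`, and `exp (L - 1) = B`; so the
  -- damping cancels the size of `G'`, leaving an absolute bound for `ε`.
  have hexp : Real.exp (-(Real.pi * r / (32 * ρ))) ≤ B⁻¹ := by
    rw [← hexpL, ← Real.exp_neg]
    apply Real.exp_le_exp.2
    have : Real.pi * r / (32 * ρ) = Real.pi * L / 2 := by
      rw [hρ]; field_simp; ring
    rw [this]
    nlinarith [Real.pi_gt_three]
  have hε : 32 * (48 * B / r) * Real.exp (-(Real.pi * r / (32 * ρ))) / r ≤ 1536 := by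
    calc _ ≤ 32 * (48 * B / r) * B⁻¹ / r := by gcongr
      _ = 1536 / (r * r) := by field_simp; norm_num
      _ ≤ 1536 := div_le_self (by norm_num) (by nlinarith)
  gcongr

end Main

theorem theorem1p1 :
    ∃ A : ℝ, 0 < A ∧
      ∀ {Ω : Type*} [MeasurableSpace Ω] (P : Measure Ω) [IsProbabilityMeasure P]
        (X : Ω → ℝ) (_ : AEMeasurable X P) (r : ℝ) (_ : 0 < r)
        (_ : Integrable (fun ω => Real.exp (r * |X ω|)) P)
        (_ : ∀ u ∈ Metric.closedBall (0 : ℂ) r, complexCharFun P X u ≠ 0),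
        ∃ M : ℝ,
          IsGreatest ((fun u : ℂ => ‖complexCharFun P X u‖) '' Metric.sphere (0 : ℂ) r) M ∧
          ksDist (P.map (centered P X)) (gaussianReal 0 1) ≤
            2 * |√(variance X P) - 1| + A * (1 + Real.posLog (Real.log M)) * r⁻¹ := by
  obtain ⟨C, hC, hgauss⟩ := exists_gaussian_approx_const
  refine ⟨160000 * C + 1, by positivity, ?_⟩
  intro Ω _ P _ X hX r hr hint hne
  have hcf : ∀ u, complexCharFun P X u = complexMGF X P (Complex.I * u) := fun u => rfl
  have hcf' : ∀ z, complexMGF X P z = complexCharFun P X (-Complex.I * z) := by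
    intro z
    rw [hcf, ← mul_assoc]
    simp
  have hcont := continuousOn_complexMGF hX hint
  obtain ⟨M, hM⟩ : ∃ M, IsGreatest
      ((fun u : ℂ => ‖complexCharFun P X u‖) '' Metric.sphere (0 : ℂ) r) M := by
    apply IsCompact.exists_isGreatest
    · apply (isCompact_sphere (0 : ℂ) r).image_of_continuousOn
      refine ContinuousOn.norm ?_
      refine hcont.comp (f := fun u : ℂ => Complex.I * u) (by fun_prop) ?_
      intro u hu
      simp only [mem_sphere_zero_iff_norm, mem_closedBall_zero_iff] at hu ⊢
      simp [hu]
    · exact (NormedSpace.sphere_nonempty.2 hr.le).image _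
  refine ⟨M, hM, ?_⟩
  have hL : 0 ≤ Real.posLog (Real.log M) := Real.posLog_nonneg
  have hY : AEMeasurable (centered P X) P := hX.sub_const _
  have : IsProbabilityMeasure (P.map (centered P X)) := Measure.isProbabilityMeasure_map hY
  set σ := √(variance X P) with hσ
  have hks1 := ksDist_le_one (P.map (centered P X)) (gaussianReal 0 1)
  -- The distance never exceeds 1, so the claim is trivial if `|σ - 1| ≥ 1/2` or `r < 1`; the `+ 1`
  -- in the constant covers the latter.
  by_cases hσ1 : 1 / 2 ≤ |σ - 1|
  · have : 0 ≤ (160000 * C + 1) * (1 + Real.posLog (Real.log M)) * r⁻¹ := by positivity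
    linarith
  rcases lt_or_ge r 1 with hr1 | hr1
  · have h1 : 1 ≤ r⁻¹ := (one_le_inv₀ hr).2 hr1.le
    have h2 : 1 ≤ (160000 * C + 1) * (1 + Real.posLog (Real.log M)) := by nlinarith
    have h3 := one_le_mul_of_one_le_of_one_le h2 h1
    have h4 := abs_nonneg (σ - 1)
    linarith
  obtain ⟨hσlow, hσup⟩ := abs_lt.1 (not_le.1 hσ1)
  have hσ0 : 0 < σ := by linarith
  have hσsq : σ ^ 2 = variance X P := Real.sq_sqrt (variance_nonneg X P)
  have hI : ∀ z : ℂ, ‖-Complex.I * z‖ = ‖z‖ := fun z => by simp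
  have hmax : ∀ z ∈ Metric.ball (0 : ℂ) r, ‖complexMGF X P z‖ ≤ M := by
    intro z hz
    refine Complex.norm_le_of_forall_mem_frontier_norm_le Metric.isBounded_ball
      (f := complexMGF X P) (U := Metric.ball 0 r) ⟨?_, ?_⟩ ?_ (subset_closure hz)
    · exact differentiableOn_complexMGF.mono
        fun w hw => re_mem_interior_integrableExpSet hX hint hw
    · rwa [closure_ball _ hr.ne']
    · intro w hw
      rw [frontier_ball _ hr.ne', mem_sphere_zero_iff_norm] at hw
      rw [hcf']
      exact hM.2 ⟨-Complex.I * w, by rw [mem_sphere_zero_iff_norm, hI, hw], rfl⟩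
  have hM1 : 1 ≤ M := by
    have := hmax 0 (Metric.mem_ball_self hr)
    simpa [complexMGF] using this
  have hne' : ∀ z ∈ Metric.ball (0 : ℂ) r, complexMGF X P z ≠ 0 := by
    intro z hz
    rw [hcf']
    apply hne
    rw [mem_closedBall_zero_iff, hI]
    exact (mem_ball_zero_iff.1 hz).le
  set ρ : ℝ := r / (16 * (1 + Real.posLog (Real.log M))) with hρ
  have hρ0 : 0 < ρ := by positivity
  have hρr : ρ < r := div_lt_self hr (by linarith)
  obtain ⟨G, hG, hGb⟩ := exists_log_complexMGF_centered hX hr1 hint hne' hM1 hmax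
    (hσsq ▸ by positivity) hρ
  have hnormI : ∀ t : ℝ, ‖(t : ℂ) * Complex.I‖ = |t| := fun t => by simp
  have hXint : Integrable X P := by
    have h0 := re_mem_interior_integrableExpSet hX hint (Metric.mem_ball_self hr)
    have h1 : MemLp X 1 P := by
      simpa using memLp_of_mem_interior_integrableExpSet (by simpa using h0) 1
    exact h1.integrable le_rfl
  have hYint : Integrable id (P.map (centered P X)) := by
    rw [integrable_map_measure aestronglyMeasurable_id hY]
    exact hXint.sub (integrable_const _)
  have happ := hgauss (P.map (centered P X)) hYint σ ρ 10000 (fun t => G (t * Complex.I))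
    (by linarith) hρ0 (by norm_num)
    (fun t ht => by
      rw [← complexMGF_mul_I hY]
      apply hG
      rw [mem_ball_zero_iff, hnormI]
      linarith)
    (fun t ht => by
      have h1 := hGb (t * Complex.I) (by rwa [hnormI])
      rw [hnormI] at h1
      have e : G (t * Complex.I) + (σ : ℂ) ^ 2 * t ^ 2 / 2
          = G (t * Complex.I) - (variance X P : ℝ) * (t * Complex.I) ^ 2 / 2 := by
        rw [← hσsq, mul_pow, Complex.I_sq]
        push_cast
        ring
      rw [e]
      refine h1.trans ?_
      -- Uses `σ < 3/2`. With the 16 in `ρ`, the value 10000 gives the 160000 in the final constant.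
      have h2 : 6 * (variance X P + 1536) ≤ 10000 := by rw [← hσsq]; nlinarith
      gcongr)
  have htri := ksDist_triangle (P.map (centered P X)) (gaussianReal 0 (σ ^ 2).toNNReal)
    (gaussianReal 0 1)
  have hcmp := ksDist_gaussianReal_le (σ := σ) (by linarith)
  have hfin : C * 10000 / ρ ≤ (160000 * C + 1) * (1 + Real.posLog (Real.log M)) * r⁻¹ := by
    have e : C * 10000 / ρ = 160000 * C * ((1 + Real.posLog (Real.log M)) * r⁻¹) := by
      rw [hρ]; field_simp; norm_num
    have h3 : 0 ≤ (1 + Real.posLog (Real.log M)) * r⁻¹ := by positivity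
    rw [e, mul_assoc (160000 * C + 1)]
    exact mul_le_mul_of_nonneg_right (by linarith) h3
  linarith
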